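/- Let $V$ be a compact connected Riemann surface of genus 2 and $\theta$ a holomorphic 1-form on $V$ whose foliation $\mathrm{Re}\,\theta=0$ is generic and irreducible: all zeros of $\theta$ are simple (the critical points are saddles), no separatrix joins two saddles or a saddle to itself, and there are no periodic trajectories. Let $a_1,b_1,a_2,b_2$ be a transversal canonical basis: simple closed $C^1$ curves transversal to the foliation such that $a_j,b_j$ cross in exactly one point, transversally, and no other two of the curves meet. Suppose that $V$ with its foliation is presented by two torus planes $C_1,C_2$ adapted to this basis, as follows. Each $C_k=\mathbb R^2$ carries the upward vertical flow with transversal measure $dx$, a lattice $\mathbb Z^2_k\subset\mathbb R^2$ generated by the shifts corresponding to $a_k,b_k$, and a transversal segment $s_k$ of transversal measure $m>0$ (the graph of a continuous function over an interval of length $m$) that is disjoint from all its nonzero lattice shifts. The surface $V$ is obtained from the tori $C_k/\mathbb Z^2_k$ by cutting them along $s_1,s_2$ and gluing, preserving the transversal measure, the upper side of each segment to the lower side of the other; the ends of the segments become the two saddles, the measured foliations correspond, and $a_k,b_k$ lie in the $k$-th torus away from $s_k$. A street over $s=s_k$ of height $v\in\mathbb Z^2_k$ is a maximal open strip of vertical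 trajectories in $C_k$, over an open interval of $s$, which go up from inner points of $s$ to inner points of $s+v$ without meeting any lattice shift of $s$ in between; its width is its transversal measure. Then for both $k=1,2$ the following holds. 1. There are exactly three streets $p^0_k,p^1_k,p^2_k$ over $s_k$; their widths $|p^\tau_k|$ and heights $h^\tau_k\in\mathbb Z^2_k$ satisfy $\sum_\tau|p^\tau_k|=m$ and $h^1_k+h^2_k=h^0_k$, and the three heights are different. 2. The streets fill $s_k$ from left to right in the order $p^1_k,p^0_k,p^2_k$. The streets $p^1_k$ and $p^2_k$ are attached to $p^0_k$ from the left and from the right and are shorter: the right end of $s_k+h^1_k$ lies on the left wall, and the left end of $s_k+h^2_k$ on the right wall of $p^0_k$, strictly between the ends of the wall. The lower and upper sides of $p^0_k$ lie strictly inside $s_k$ and $s_k+h^0_k$. 3. The picture is invariant under the involution which reverses the time of the flow and the orientation of the transversal segments: for the reversed plane (the image of $C_k$ under a rotation by $180^\circ$ that carries $s_k$ to a segment over the same interval) the same heights and the same intervals of $s_k$ give its three streets, and 1, 2, 4 hold for it too. 4. The three streets are disjoint, and their union $D$ is a fundamental domain of $\mathbb Z^2_k$ in $C_k$: $D$ is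 open, its distinct lattice shifts are disjoint, and the lattice shifts of its closure cover $C_k$. -/

import Mathlib

open Set Filter Topology
open scoped Manifold ContDiff

noncomputable section

/-! ### Holomorphic 1-forms and their foliations on a Riemann surface -/

section Surface

variable {V : Type*} [TopologicalSpace V] [ChartedSpace ℂ V]

/-- A field of complex-linear functionals on the tangent spaces of `V`. -/
abbrev CotangentField (V : Type*) [TopologicalSpace V] [ChartedSpace ℂ V] : Type _ :=
  (p : V) → (TangentSpace 𝓘(ℂ) p →L[ℂ] ℂ)

/-- `f` is a holomorphic primitive of `θ` near `p`. -/
def IsPrimitiveNear (θ : CotangentField V) (p : V) (f : V → ℂ) : Prop :=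
  ∀ᶠ q in 𝓝 p, HasMFDerivAt 𝓘(ℂ) 𝓘(ℂ) f q (θ q)

/-- The space of holomorphic 1-forms: the fields which near every point are the differential of a
holomorphic function. -/
def holomorphicForms (V : Type*) [TopologicalSpace V] [ChartedSpace ℂ V] :
    Submodule ℂ (CotangentField V) where
  carrier := {θ | ∀ p, ∃ f, IsPrimitiveNear θ p f}
  add_mem' := by
    intro θ η hθ hη p
    obtain ⟨f, hf⟩ := hθ p
    obtain ⟨g, hg⟩ := hη p
    refine ⟨f + g, ?_⟩
    filter_upwards [hf, hg] with q h1 h2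
    exact h1.add h2
  zero_mem' := by
    intro p
    exact ⟨fun _ => 0, Eventually.of_forall fun q => hasMFDerivAt_const 0 q⟩
  smul_mem' := by
    intro c θ hθ p
    obtain ⟨f, hf⟩ := hθ p
    refine ⟨c • f, ?_⟩
    filter_upwards [hf] with q h1
    exact h1.const_smul c

/-- The genus: the dimension of the space of holomorphic 1-forms. -/
def genus (V : Type*) [TopologicalSpace V] [ChartedSpace ℂ V] : ℕ :=
  Module.finrank ℂ (holomorphicForms V)

/-- The restriction of the path `γ` to `[0,1]` runs inside a level of the (locally defined)
function `Re ∫ θ`, i.e. along the foliation `Re θ = 0`. -/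
def IsLeafPath (θ : CotangentField V) (γ : ℝ → V) : Prop :=
  ContinuousOn γ (Icc 0 1) ∧
    ∀ t ∈ Icc (0 : ℝ) 1, ∀ f, IsPrimitiveNear θ (γ t) f →
      ∀ᶠ τ in 𝓝[Icc 0 1] t, (f (γ τ)).re = (f (γ t)).re

/-- Genericity and irreducibility of the foliation `Re θ = 0`: all critical points are
nondegenerate (simple zeros of `θ`, i.e. saddles), no separatrix joins two saddles (or a saddle to
itself), and there is no periodic trajectory. -/
structure IsGenericFoliation (θ : CotangentField V) : Prop where
  simple_zeros : ∀ p, θ p = 0 → ∀ f, IsPrimitiveNear θ p f →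
    deriv (deriv (f ∘ (extChartAt 𝓘(ℂ) p).symm)) (extChartAt 𝓘(ℂ) p p) ≠ 0
  no_saddle_connection : ¬ ∃ γ : ℝ → V, IsLeafPath θ γ ∧ InjOn γ (Ioo 0 1) ∧
    θ (γ 0) = 0 ∧ θ (γ 1) = 0 ∧ ∀ t ∈ Ioo (0 : ℝ) 1, θ (γ t) ≠ 0
  no_periodic_leaf : ¬ ∃ γ : ℝ → V, IsLeafPath θ γ ∧ InjOn γ (Ico 0 1) ∧
    γ 0 = γ 1 ∧ ∀ t ∈ Icc (0 : ℝ) 1, θ (γ t) ≠ 0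

/-- `c` (with period 1) is a simple closed `C¹` curve transversal to the foliation `Re θ = 0`;
`u t = θ (c' t)` is its velocity, read in the local coordinate `∫ θ`. -/
structure IsTransversalCycle (θ : CotangentField V) (c : ℝ → V) (u : ℝ → ℂ) : Prop where
  continuous : Continuous c
  periodic : Function.Periodic c 1
  simple : InjOn c (Ico 0 1)
  continuous_velocity : Continuous u
  regular : ∀ t, θ (c t) ≠ 0
  velocity : ∀ t f, IsPrimitiveNear θ (c t) f → HasDerivAt (fun τ => f (c τ)) (u t) t
  transversal : ∀ t, (u t).re ≠ 0

/-- `a 0, b 0, a 1, b 1` is a transversal canonical basis for genus 2: simple closed curves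
transversal to the foliation; `a j` and `b j` cross each other in exactly one point, and
transversally (their velocities are linearly independent over `ℝ`); no other two meet. -/
def IsTransversalCanonicalBasis (θ : CotangentField V) (a b : Fin 2 → ℝ → V) : Prop :=
  ∃ ua ub : Fin 2 → ℝ → ℂ,
    (∀ j, IsTransversalCycle θ (a j) (ua j)) ∧ (∀ j, IsTransversalCycle θ (b j) (ub j)) ∧
    (∀ j, ∃ t s, a j t = b j s ∧ ((starRingEnd ℂ) (ua j t) * ub j s).im ≠ 0 ∧
      range (a j) ∩ range (b j) = {a j t}) ∧
    (∀ i j, i ≠ j → Disjoint (range (a i)) (range (a j)) ∧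
      Disjoint (range (b i)) (range (b j)) ∧ Disjoint (range (a i)) (range (b j)))

end Surface

/-! ### Torus planes with a periodic family of transversal segments -/

/-- The universal covering plane of a 2-torus with the vertical straight line flow (upwards): the
plane `ℝ × ℝ`, the lattice generated by the independent vectors `A`, `B`, and a segment transversal
to the flow, of transversal measure `m`. The segment is the graph of `φ` over `[0, m]` and does not
meet its shifts by lattice vectors, i.e. it is a segment embedded in the torus. -/
structure TorusPlane (m : ℝ) where
  A : ℝ × ℝ
  B : ℝ × ℝ
  indep : LinearIndependent ℝ ![A, B]
  m_pos : 0 < m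
  φ : ℝ → ℝ
  φ_cont : ContinuousOn φ (Icc 0 m)
  embedded : ∀ v ∈ AddSubgroup.closure {A, B}, v ≠ 0 →
    ∀ x ∈ Icc 0 m, x - v.1 ∈ Icc 0 m → φ x ≠ φ (x - v.1) + v.2

namespace TorusPlane

variable {m : ℝ} (C : TorusPlane m)

/-- The lattice of the plane. -/
def lattice : AddSubgroup (ℝ × ℝ) := AddSubgroup.closure {C.A, C.B}

/-- The (closed) transversal segment. -/
def seg : Set (ℝ × ℝ) := {p | p.1 ∈ Icc 0 m ∧ p.2 = C.φ p.1}

/-- The transversal segment without its ends. -/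
def openSeg : Set (ℝ × ℝ) := {p | p.1 ∈ Ioo 0 m ∧ p.2 = C.φ p.1}

/-- The left end of the segment. -/
def leftEnd : ℝ × ℝ := (0, C.φ 0)

/-- The right end of the segment. -/
def rightEnd : ℝ × ℝ := (m, C.φ m)

/-- The plane without all the shifts of the closed segment. -/
def slitPlane : Set (ℝ × ℝ) := {p | ∀ v ∈ C.lattice, p - v ∉ C.seg}

/-- The plane without all the shifts of the open segment (the ends are kept). -/
def slitPlaneWithEnds : Set (ℝ × ℝ) := {p | ∀ v ∈ C.lattice, p - v ∉ C.openSeg}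

/-- The second coordinate of the point over `x` of the segment shifted by `v`. -/
def top (v : ℝ × ℝ) (x : ℝ) : ℝ := C.φ (x - v.1) + v.2

/-- The trajectory which starts upwards at the inner point over `x` of the segment ends at an inner
point of the segment shifted by `v`, without meeting any segment of the family in between. -/
def Reaches (v : ℝ × ℝ) (x : ℝ) : Prop :=
  x ∈ Ioo 0 m ∧ x - v.1 ∈ Ioo 0 m ∧ C.φ x < C.top v x ∧
    ∀ y ∈ Ioo (C.φ x) (C.top v x), (x, y) ∈ C.slitPlane

/-- The trajectories which start over `(c, d)` form a strip from the segment to its shift by `v`. -/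
def IsStrip (v : ℝ × ℝ) (c d : ℝ) : Prop :=
  v ∈ C.lattice ∧ c < d ∧ ∀ x ∈ Ioo c d, C.Reaches v x

/-- A street: a strip that cannot be extended to the left or to the right. Its height is the
lattice vector `v` and its width is `d - c`. -/
def IsStreet (v : ℝ × ℝ) (c d : ℝ) : Prop :=
  C.IsStrip v c d ∧ ∀ c' d', c' ≤ c → d ≤ d' → C.IsStrip v c' d' → c' = c ∧ d' = d

/-- The (open) region of the plane filled by the strip over `(c, d)` up to the shift by `v`. -/
def region (v : ℝ × ℝ) (c d : ℝ) : Set (ℝ × ℝ) :=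
  {p | p.1 ∈ Ioo c d ∧ p.2 ∈ Ioo (C.φ p.1) (C.top v p.1)}

/-- The open set `D` is a fundamental domain of the lattice: distinct shifts of `D` are disjoint,
and the shifts of the closure of `D` cover the plane. -/
def IsFundamentalDomain (D : Set (ℝ × ℝ)) : Prop :=
  IsOpen D ∧
    (∀ v ∈ C.lattice, v ≠ 0 → Disjoint D ((fun p => p + v) '' D)) ∧
    (⋃ v ∈ C.lattice, (fun p => p + v) '' closure D) = univ

/-- The image of the plane under the involution `p ↦ (m, 0) - p`, which reverses the time of the
flow and the orientation of the transversal segments. -/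
def reverse : TorusPlane m where
  A := C.A
  B := C.B
  indep := C.indep
  m_pos := C.m_pos
  φ := fun x => - C.φ (m - x)
  φ_cont := by
    refine (C.φ_cont.comp (f := fun x => m - x) (by fun_prop) ?_).neg
    intro x hx
    simp only [mem_Icc] at hx ⊢
    constructor <;> linarith [hx.1, hx.2]
  embedded := by
    intro v hv hv0 x hx hxv h
    refine C.embedded v hv hv0 (m - x + v.1) ?_ ?_ ?_
    · simp only [mem_Icc] at hxv ⊢
      constructor <;> linarith [hxv.1, hxv.2]
    · simp only [mem_Icc] at hx ⊢
      constructor <;> linarith [hx.1, hx.2]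
    · have e1 : m - (x - v.1) = m - x + v.1 := by ring
      have e2 : m - x + v.1 - v.1 = m - x := by ring
      rw [e1] at h
      rw [e2]
      linarith

/-- The three-street picture: street number `τ` has height `h τ` and lies over `(l τ, r τ)`. -/
structure ThreeStreets (h : Fin 3 → ℝ × ℝ) (l r : Fin 3 → ℝ) : Prop where
  /-- The streets numbered `0, 1, 2` are all the streets that start in the segment. -/
  streets : ∀ v c d, C.IsStreet v c d ↔ ∃ τ, v = h τ ∧ c = l τ ∧ d = r τ
  /-- They are different. -/
  injective : Function.Injective h
  /-- Their widths add up to `m`. -/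
  widths : ∑ τ, (r τ - l τ) = m
  /-- The relation between the heights. -/
  heights : h 1 + h 2 = h 0
  /-- From left to right the streets `1, 0, 2` follow each other along the whole segment. -/
  left : l 1 = 0
  left_attached : r 1 = l 0
  right_attached : r 0 = l 2
  right : r 2 = m
  /-- Street 1 is shorter than street 0: on their common wall, the right end of the upper segment
  of street 1 lies strictly between the lower and the upper end of street 0. -/
  left_wall : (C.rightEnd + h 1).1 = l 0 ∧
    (C.rightEnd + h 1).2 ∈ Ioo (C.φ (l 0)) (C.top (h 0) (l 0))
  /-- Street 2 is shorter than street 0: on their common wall, the left end of the upper segment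
  of street 2 lies strictly between the lower and the upper end of street 0. -/
  right_wall : (C.leftEnd + h 2).1 = r 0 ∧
    (C.leftEnd + h 2).2 ∈ Ioo (C.φ (r 0)) (C.top (h 0) (r 0))
  /-- The lower and the upper side of street 0 lie strictly inside of their segments. -/
  inside : 0 < l 0 ∧ r 0 < m ∧ 0 < l 0 - (h 0).1 ∧ r 0 - (h 0).1 < m
  /-- The three streets do not overlap, and together form a fundamental domain of the lattice. -/
  disjoint : ∀ τ τ', τ ≠ τ' →
    Disjoint (C.region (h τ) (l τ) (r τ)) (C.region (h τ') (l τ') (r τ'))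
  fundamental_domain : C.IsFundamentalDomain (⋃ τ, C.region (h τ) (l τ) (r τ))

end TorusPlane

/-! ### The two torus planes of a genus 2 foliation -/

/-- The surface `V` with the foliation `Re θ = 0` and the transversal canonical basis `a, b` is
obtained from two torus planes `C 0`, `C 1` by cutting the tori along their transversal segments of
measure `m` and gluing crosswise: the upper side of each segment with the lower side of the other
one, preserving the transversal measure. -/
structure TorusDecomposition {V : Type*} [TopologicalSpace V] [ChartedSpace ℂ V]
    (θ : CotangentField V) (a b : Fin 2 → ℝ → V) (m : ℝ) where
  /-- The two planes. -/
  C : Fin 2 → TorusPlane m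
  /-- The projections of the slit planes to the surface. -/
  proj : Fin 2 → ℝ × ℝ → V
  /-- The transversal arcs of `V` that cut it into the two pieces: `arc k` is the upper side of the
  segment of `C k` and the lower side of the segment of the other plane. -/
  arc : Fin 2 → ℝ → V
  /-- The saddles at the left and right ends of the arcs. -/
  saddleLeft : V
  saddleRight : V
  saddles : ∀ p, θ p = 0 ↔ p = saddleLeft ∨ p = saddleRight
  saddles_ne : saddleLeft ≠ saddleRight
  /-- The projection is continuous (also at the ends of the segments), open, and identifies exactly
  the points that differ by a lattice vector. -/
  proj_continuous : ∀ k, ContinuousOn (proj k) (C k).slitPlaneWithEnds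
  proj_open : ∀ k U, IsOpen U → U ⊆ (C k).slitPlane → IsOpen (proj k '' U)
  proj_periodic : ∀ k p, ∀ v ∈ (C k).lattice, proj k (p + v) = proj k p
  proj_injective : ∀ k, ∀ p ∈ (C k).slitPlane, ∀ q ∈ (C k).slitPlane,
    proj k p = proj k q → q - p ∈ (C k).lattice
  /-- The projection carries the vertical foliation with the measure `dx` to `Re θ`. -/
  proj_measure : ∀ k, ∀ p ∈ (C k).slitPlane, ∀ f, IsPrimitiveNear θ (proj k p) f →
    ∀ᶠ q in 𝓝 p, (f (proj k q)).re - (f (proj k p)).re = q.1 - p.1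
  proj_leftEnd : ∀ k, proj k (C k).leftEnd = saddleLeft
  proj_rightEnd : ∀ k, proj k (C k).rightEnd = saddleRight
  /-- The gluing of the sides of the segments. -/
  arc_continuous : ∀ k, ContinuousOn (arc k) (Icc 0 m)
  arc_left : ∀ k, arc k 0 = saddleLeft
  arc_right : ∀ k, arc k m = saddleRight
  upper_side : ∀ k, ∀ x ∈ Ioo 0 m,
    Tendsto (proj k) (𝓝[{q | q.1 ∈ Ioo 0 m ∧ (C k).φ q.1 < q.2}] (x, (C k).φ x)) (𝓝 (arc k x))
  lower_side : ∀ k, ∀ x ∈ Ioo 0 m,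
    Tendsto (proj k) (𝓝[{q | q.1 ∈ Ioo 0 m ∧ q.2 < (C k).φ q.1}] (x, (C k).φ x))
      (𝓝 (arc (k + 1) x))
  /-- The surface is the disjoint union of the two open pieces, the two open arcs and the two
  saddles. -/
  arc_injective : ∀ k k', ∀ x ∈ Ioo 0 m, ∀ x' ∈ Ioo 0 m, arc k x = arc k' x' → k = k' ∧ x = x'
  arc_ne_saddle : ∀ k, ∀ x ∈ Ioo 0 m, arc k x ≠ saddleLeft ∧ arc k x ≠ saddleRight
  proj_ne_saddle : ∀ k, ∀ p ∈ (C k).slitPlane, proj k p ≠ saddleLeft ∧ proj k p ≠ saddleRight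
  proj_ne_arc : ∀ k k', ∀ p ∈ (C k).slitPlane, ∀ x ∈ Ioo 0 m, proj k p ≠ arc k' x
  pieces_disjoint : Disjoint (proj 0 '' (C 0).slitPlane) (proj 1 '' (C 1).slitPlane)
  covers : ∀ p, p = saddleLeft ∨ p = saddleRight ∨ (∃ k, ∃ x ∈ Ioo 0 m, arc k x = p) ∨
    ∃ k, p ∈ proj k '' (C k).slitPlane
  /-- The cycles `a k`, `b k` lie in the piece number `k`, and the lattice of the plane `C k` is
  generated by the corresponding shifts `A`, `B`. -/
  lift_a : ∀ k, ∃ c : ℝ → ℝ × ℝ, Continuous c ∧ (∀ t, c t ∈ (C k).slitPlane) ∧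
    (∀ t, proj k (c t) = a k t) ∧ ∀ t, c (t + 1) = c t + (C k).A
  lift_b : ∀ k, ∃ c : ℝ → ℝ × ℝ, Continuous c ∧ (∀ t, c t ∈ (C k).slitPlane) ∧
    (∀ t, proj k (c t) = b k t) ∧ ∀ t, c (t + 1) = c t + (C k).B

end

/-!
The statement is about the first return of the upward vertical flow to the segment in one torus plane.
Of the surface only two facts are used (`TorusDecomposition.isIrreducible`). A vertical segment of
the slit plane that joins two ends of shifts of the transversal segment would project to a saddle
connection, so there is none; and if the lattice contains a vertical vector, then every vertical
line meets a shift of the segment, since otherwise it would project to a periodic leaf. They form the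
structure `TorusPlane.IsIrreducible`, which is invariant under the reversal of the plane.

Given this, every vertical trajectory meets the shifts of the segment, upwards and downwards: either by
vertical periodicity, or because a lattice vector which is steep and nearly vertical (Dirichlet's
principle) has a multiple that carries the segment under the given point. The shifts are locally
finite, so there are first hits. Going down from the right and from the left end one first
hits inner points of shifts; equivalently, exactly two points `m + g₁.1` and `g₂.1` of the segment see
the right end of its shift by `g₁` and the left end of its shift by `g₂` (`TorusPlane.Cuts`). Away from
these two cuts the shift that is hit first is locally constant, and each interval between
consecutive cuts or ends is a street. If the cut at `g₂.1` were the left one, the middle street would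
have both ends of one and the same shift on its walls and hence width `m`; so the order is
`m + g₁.1 < g₂.1`.

The first return is injective, so the three image intervals are disjoint, and their lengths add
up to `m`; this forces them to fill the segment in the opposite order and gives
`g₁.1 + g₂.1 = g₀.1` for the middle height `g₀`. The vector identity `g₁ + g₂ = g₀` also has to
hold when the lattice contains vertical vectors. Here `g₁` and `g₀ - g₂` both put the right end
of the segment on the left wall of the middle street, and two different such ends would give two
consecutive ones, hence a saddle connection (`TorusPlane.StreetData.add_eq`).

The streets and their shifts are disjoint, because a point determines the gap of its vertical line
that contains it. They contain all points outside of countably many vertical lines and of the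
shifts of the segment, hence a dense set, and a locally finite union of closed sets is closed; so
their closures cover the plane. Finally the involution maps streets to streets and
keeps the data of each of the three, and the order of the streets along the segment determines
their numbering.
-/


namespace TorusPlane

variable {m : ℝ} (C : TorusPlane m)

/-! ### The lattice -/

theorem mem_lattice_iff {v : ℝ × ℝ} : v ∈ C.lattice ↔ ∃ i j : ℤ, i • C.A + j • C.B = v :=
  AddSubgroup.mem_closure_pair

theorem det_ne_zero : C.A.1 * C.B.2 - C.A.2 * C.B.1 ≠ 0 := by
  intro hd
  have hi := LinearIndependent.pair_iff.1 C.indep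
  obtain ⟨hB1, hA1⟩ := hi C.B.1 (-C.A.1) (by
    ext
    · simp; ring
    · simp; linarith)
  obtain ⟨-, hA2⟩ := hi C.B.2 (-C.A.2) (by
    ext
    · simp; linarith
    · simp; ring)
  have hA : C.A = 0 := Prod.ext (neg_eq_zero.1 hA1) (neg_eq_zero.1 hA2)
  exact one_ne_zero (hi 1 0 (by simp [hA])).1

theorem lattice_countable : (C.lattice : Set (ℝ × ℝ)).Countable := by
  refine (countable_range fun ij : ℤ × ℤ => ij.1 • C.A + ij.2 • C.B).mono ?_
  intro v hv
  obtain ⟨i, j, h⟩ := C.mem_lattice_iff.1 hv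
  exact ⟨(i, j), h⟩

theorem lattice_finite (R : ℝ) : {v | v ∈ C.lattice ∧ |v.1| ≤ R ∧ |v.2| ≤ R}.Finite := by
  set d := C.A.1 * C.B.2 - C.A.2 * C.B.1 with hd
  have hd0 : 0 < |d| := abs_pos.2 C.det_ne_zero
  set S := R * (|C.A.1| + |C.A.2| + |C.B.1| + |C.B.2|) / |d| with hS
  have key : ∀ (i : ℤ) (a b s t : ℝ), |a| ≤ R → |b| ≤ R → (i : ℝ) * d = a * s - b * t →
      |s| + |t| ≤ |C.A.1| + |C.A.2| + |C.B.1| + |C.B.2| → i ∈ Icc (-⌈S⌉) ⌈S⌉ := by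
    intro i a b s t ha hb h hst
    have hR : 0 ≤ R := (abs_nonneg a).trans ha
    have h1 : |(i : ℝ)| * |d| ≤ R * (|C.A.1| + |C.A.2| + |C.B.1| + |C.B.2|) := by
      rw [← abs_mul, h]
      calc |a * s - b * t| ≤ |a| * |s| + |b| * |t| := by
            rw [← abs_mul, ← abs_mul]; exact abs_sub _ _
        _ ≤ R * |s| + R * |t| := by gcongr
        _ = R * (|s| + |t|) := by ring
        _ ≤ _ := by gcongr
    have h2 : |(i : ℝ)| ≤ S := (le_div_iff₀ hd0).2 h1
    have h3 := abs_le.1 (h2.trans (Int.le_ceil S))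
    constructor
    · exact_mod_cast h3.1
    · exact_mod_cast h3.2
  refine (((finite_Icc (-⌈S⌉) ⌈S⌉).prod (finite_Icc (-⌈S⌉) ⌈S⌉)).image
    fun ij : ℤ × ℤ => ij.1 • C.A + ij.2 • C.B).subset ?_
  rintro v ⟨hv, h1, h2⟩
  obtain ⟨i, j, rfl⟩ := C.mem_lattice_iff.1 hv
  refine ⟨(i, j), ⟨key i _ _ C.B.2 C.B.1 h1 h2 ?_ ?_, key j _ _ C.A.1 C.A.2 h2 h1 ?_ ?_⟩, rfl⟩
  · simp [hd]; ring
  · linarith [abs_nonneg C.A.1, abs_nonneg C.A.2]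
  · simp [hd]; ring
  · linarith [abs_nonneg C.B.1, abs_nonneg C.B.2]

/-- The lattice is coarsely dense in the plane. -/
theorem exists_lattice_near : ∃ R, 0 ≤ R ∧ ∀ q : ℝ × ℝ, ∃ v ∈ C.lattice,
    |q.1 - v.1| ≤ R ∧ |q.2 - v.2| ≤ R := by
  set d := C.A.1 * C.B.2 - C.A.2 * C.B.1 with hd
  have hd0 : d ≠ 0 := C.det_ne_zero
  refine ⟨|C.A.1| + |C.A.2| + |C.B.1| + |C.B.2|, by positivity, fun q => ?_⟩
  set α := (q.1 * C.B.2 - q.2 * C.B.1) / d with hα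
  set β := (C.A.1 * q.2 - C.A.2 * q.1) / d with hβ
  have key : ∀ s t : ℝ, |Int.fract α * s + Int.fract β * t| ≤ |s| + |t| := by
    intro s t
    refine (abs_add_le _ _).trans (add_le_add ?_ ?_)
    · rw [abs_mul, abs_of_nonneg (Int.fract_nonneg α)]
      exact mul_le_of_le_one_left (abs_nonneg _) (Int.fract_lt_one α).le
    · rw [abs_mul, abs_of_nonneg (Int.fract_nonneg β)]
      exact mul_le_of_le_one_left (abs_nonneg _) (Int.fract_lt_one β).le
  have e1 : q.1 = α * C.A.1 + β * C.B.1 := by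
    rw [hα, hβ]; field_simp; rw [hd]; ring
  have e2 : q.2 = α * C.A.2 + β * C.B.2 := by
    rw [hα, hβ]; field_simp; rw [hd]; ring
  refine ⟨⌊α⌋ • C.A + ⌊β⌋ • C.B, C.mem_lattice_iff.2 ⟨_, _, rfl⟩, ?_, ?_⟩
  · have : q.1 - (⌊α⌋ • C.A + ⌊β⌋ • C.B).1 = Int.fract α * C.A.1 + Int.fract β * C.B.1 := by
      rw [e1, ← Int.self_sub_floor, ← Int.self_sub_floor]; simp [-Int.self_sub_floor]; ring
    rw [this]
    linarith [key C.A.1 C.B.1, abs_nonneg C.A.2, abs_nonneg C.B.2]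
  · have : q.2 - (⌊α⌋ • C.A + ⌊β⌋ • C.B).2 = Int.fract α * C.A.2 + Int.fract β * C.B.2 := by
      rw [e2, ← Int.self_sub_floor, ← Int.self_sub_floor]; simp [-Int.self_sub_floor]; ring
    rw [this]
    linarith [key C.A.2 C.B.2, abs_nonneg C.A.1, abs_nonneg C.B.1]

/-- Dirichlet's principle: there are arbitrarily high lattice vectors which are almost vertical. -/
theorem exists_lattice_high {ε : ℝ} (hε : 0 < ε) (M : ℝ) :
    ∃ u ∈ C.lattice, |u.1| ≤ ε ∧ M < u.2 := by
  obtain ⟨R, hR, hnear⟩ := C.exists_lattice_near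
  set K := |M| + 2 * R + 1 with hK
  choose v hv h1 h2 using fun n : ℕ => hnear (0, n * K)
  have hb : ∀ n, (v n).1 ∈ Icc (-R) R := by
    intro n
    have := abs_le.1 (h1 n)
    simp only at this
    constructor <;> linarith [this.1, this.2]
  obtain ⟨a, -, s, hs, hlim⟩ := isCompact_Icc.tendsto_subseq hb
  obtain ⟨N, hN⟩ := Metric.cauchySeq_iff.1 hlim.cauchySeq ε hε
  refine ⟨v (s (N + 1)) - v (s N), C.lattice.sub_mem (hv _) (hv _), ?_, ?_⟩
  · have := hN (N + 1) (by omega) N le_rfl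
    rw [Real.dist_eq] at this
    exact this.le
  · have a1 := abs_le.1 (h2 (s (N + 1)))
    have a2 := abs_le.1 (h2 (s N))
    have a3 : s N + 1 ≤ s (N + 1) := hs (Nat.lt_succ_self N)
    have a4 : ((s N : ℝ) + 1) ≤ s (N + 1) := by exact_mod_cast a3
    have a5 : 0 < K := by positivity
    have a6 := mul_le_mul_of_nonneg_right a4 a5.le
    simp only [Prod.snd_sub] at *
    linarith [le_abs_self M, a1.1, a1.2, a2.1, a2.2]

/-! ### The segment and its shifts -/

/-- A continuous extension of `φ` to the whole line. -/
noncomputable def ext : ℝ → ℝ := IccExtend C.m_pos.le ((Icc 0 m).domRestrict C.φ)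

theorem ext_continuous : Continuous C.ext :=
  (continuousOn_iff_continuous_domRestrict.1 C.φ_cont).Icc_extend'

theorem ext_eq {x : ℝ} (hx : x ∈ Icc 0 m) : C.ext x = C.φ x := by
  rw [ext, IccExtend_of_mem _ _ hx]; rfl

theorem exists_bound : ∃ S, 0 ≤ S ∧ ∀ x ∈ Icc 0 m, |C.φ x| ≤ S := by
  obtain ⟨S, hS⟩ := isCompact_Icc.exists_bound_of_continuousOn C.φ_cont
  exact ⟨|S|, abs_nonneg _, fun x hx => (hS x hx).trans (le_abs_self S)⟩

theorem notMem_slitPlane_iff {x y : ℝ} :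
    (x, y) ∉ C.slitPlane ↔ ∃ v ∈ C.lattice, x - v.1 ∈ Icc 0 m ∧ y = C.top v x := by
  simp only [slitPlane, seg, mem_ofPred_eq, not_forall, not_not, exists_prop, top, Prod.fst_sub,
    Prod.snd_sub, sub_eq_iff_eq_add]

theorem top_notMem_slitPlane {v : ℝ × ℝ} (hv : v ∈ C.lattice) {x : ℝ} (hx : x - v.1 ∈ Icc 0 m) :
    (x, C.top v x) ∉ C.slitPlane :=
  C.notMem_slitPlane_iff.2 ⟨v, hv, hx, rfl⟩

@[simp] theorem top_zero (x : ℝ) : C.top 0 x = C.φ x := by simp [top]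

theorem base_notMem_slitPlane {x : ℝ} (hx : x ∈ Icc 0 m) : (x, C.φ x) ∉ C.slitPlane := by
  simpa using C.top_notMem_slitPlane C.lattice.zero_mem (x := x) (by simpa using hx)

/-- Different shifts of the segment are disjoint. -/
theorem eq_of_top_eq {u v : ℝ × ℝ} (hu : u ∈ C.lattice) (hv : v ∈ C.lattice) {x : ℝ}
    (hxu : x - u.1 ∈ Icc 0 m) (hxv : x - v.1 ∈ Icc 0 m) (h : C.top u x = C.top v x) : u = v := by
  by_contra hne
  refine C.embedded (u - v) (C.lattice.sub_mem hu hv) (sub_ne_zero.2 hne) (x - v.1) hxv ?_ ?_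
  · simpa using hxu
  · simp only [top] at h
    simp only [Prod.fst_sub, Prod.snd_sub, sub_sub_sub_cancel_right]
    linarith

theorem top_add (u v : ℝ × ℝ) (x : ℝ) : C.top (u + v) (x + v.1) = C.top u x + v.2 := by
  simp only [top, Prod.fst_add, Prod.snd_add]
  rw [show x + v.1 - (u.1 + v.1) = x - u.1 by ring]
  ring

theorem add_mem_slitPlane_iff {v : ℝ × ℝ} (hv : v ∈ C.lattice) (p : ℝ × ℝ) :
    p + v ∈ C.slitPlane ↔ p ∈ C.slitPlane := by
  constructor
  · intro h u hu
    have := h (u + v) (C.lattice.add_mem hu hv)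
    rwa [add_sub_add_right_eq_sub] at this
  · intro h u hu
    have := h (u - v) (C.lattice.sub_mem hu hv)
    rwa [show p - (u - v) = p + v - u by abel] at this

/-- Only finitely many shifts of the segment come near a bounded part of a vertical line. -/
theorem finite_near (x r y Y : ℝ) : {v | v ∈ C.lattice ∧ ∃ x' ∈ Icc (x - r) (x + r),
    x' - v.1 ∈ Icc 0 m ∧ C.top v x' ∈ Icc y Y}.Finite := by
  obtain ⟨S, hS, hφ⟩ := C.exists_bound
  refine (C.lattice_finite (|x| + |r| + m + |y| + |Y| + S)).subset ?_
  rintro v ⟨hv, x', hx', hxv, ht⟩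
  have h1 := abs_le.1 (hφ _ hxv)
  have := C.m_pos
  simp only [top, mem_Icc] at *
  refine ⟨hv, abs_le.2 ⟨?_, ?_⟩, abs_le.2 ⟨?_, ?_⟩⟩ <;>
  linarith [neg_abs_le x, le_abs_self x, neg_abs_le r, le_abs_self r, neg_abs_le y, le_abs_self y,
    neg_abs_le Y, le_abs_self Y, abs_nonneg x, abs_nonneg r, abs_nonneg y, abs_nonneg Y]

theorem finite_hits (x y Y : ℝ) : {t | t ∈ Icc y Y ∧ (x, t) ∉ C.slitPlane}.Finite := by
  refine ((C.finite_near x 0 y Y).image fun v => C.top v x).subset ?_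
  rintro t ⟨ht, hs⟩
  obtain ⟨v, hv, hx, rfl⟩ := C.notMem_slitPlane_iff.1 hs
  exact ⟨v, ⟨hv, x, by simp, hx, ht⟩, rfl⟩

/-! ### Gaps between the shifts along a vertical line -/

/-- The vertical interval over `x` from `y₀` to `y₁` joins two points of the shifts of the segment
and meets no shift in between. -/
structure Gap (x y₀ y₁ : ℝ) : Prop where
  lt : y₀ < y₁
  low : (x, y₀) ∉ C.slitPlane
  high : (x, y₁) ∉ C.slitPlane
  clear : ∀ y ∈ Ioo y₀ y₁, (x, y) ∈ C.slitPlane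

variable {C}

/-- A gap is determined by any point `t` of it. -/
theorem Gap.eq_of_mem {x y₀ y₁ z₀ z₁ t : ℝ} (h : C.Gap x y₀ y₁) (h' : C.Gap x z₀ z₁)
    (ht : t ∈ Ioo y₀ y₁) (ht' : t ∈ Ioo z₀ z₁) : y₀ = z₀ ∧ y₁ = z₁ := by
  refine ⟨le_antisymm ?_ ?_, le_antisymm ?_ ?_⟩ <;> by_contra! hlt
  · exact h.low (h'.clear _ ⟨hlt, ht.1.trans ht'.2⟩)
  · exact h'.low (h.clear _ ⟨hlt, ht'.1.trans ht.2⟩)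
  · exact h'.high (h.clear _ ⟨ht.1.trans ht'.2, hlt⟩)
  · exact h.high (h'.clear _ ⟨ht'.1.trans ht.2, hlt⟩)

theorem Gap.high_unique {x y₀ y₁ z₁ : ℝ} (h : C.Gap x y₀ y₁) (h' : C.Gap x y₀ z₁) : y₁ = z₁ := by
  obtain ⟨t, h1, h2⟩ := exists_between (lt_min h.lt h'.lt)
  exact (h.eq_of_mem h' ⟨h1, h2.trans_le (min_le_left _ _)⟩ ⟨h1, h2.trans_le (min_le_right _ _)⟩).2

theorem Gap.low_unique {x y₀ y₁ z₀ : ℝ} (h : C.Gap x y₀ y₁) (h' : C.Gap x z₀ y₁) : y₀ = z₀ := by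
  obtain ⟨t, h1, h2⟩ := exists_between (max_lt h.lt h'.lt)
  exact (h.eq_of_mem h' ⟨(le_max_left _ _).trans_lt h1, h2⟩ ⟨(le_max_right _ _).trans_lt h1, h2⟩).1

theorem Gap.add {x y₀ y₁ : ℝ} (h : C.Gap x y₀ y₁) {v : ℝ × ℝ} (hv : v ∈ C.lattice) :
    C.Gap (x + v.1) (y₀ + v.2) (y₁ + v.2) where
  lt := by linarith [h.lt]
  low := fun h' => h.low ((C.add_mem_slitPlane_iff hv (x, y₀)).1 h')
  high := fun h' => h.high ((C.add_mem_slitPlane_iff hv (x, y₁)).1 h')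
  clear := by
    intro y hy
    have := (C.add_mem_slitPlane_iff hv (x, y - v.2)).2
      (h.clear _ ⟨by linarith [hy.1], by linarith [hy.2]⟩)
    rwa [show (x, y - v.2) + v = (x + v.1, y) from Prod.ext rfl (sub_add_cancel _ _)] at this

variable (C)

/-- The ends of the shifts of the segment. -/
def IsEnd (p : ℝ × ℝ) : Prop := ∃ v ∈ C.lattice, p = C.leftEnd + v ∨ p = C.rightEnd + v

/-- The part of genericity and irreducibility that is visible in the slit plane: no gap joins two
ends, and if the lattice has a vertical vector (so that vertical lines are closed in the torus), then
every vertical line meets a shift of the segment. -/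
structure IsIrreducible : Prop where
  no_connection : ∀ x y₀ y₁, C.Gap x y₀ y₁ → C.IsEnd (x, y₀) → C.IsEnd (x, y₁) → False
  no_loop : ∀ x w : ℝ, 0 < w → (0, w) ∈ C.lattice → ∃ y, (x, y) ∉ C.slitPlane

/-! ### Reversal -/

theorem mem_reverse_slitPlane_iff (x y : ℝ) :
    (x, y) ∈ C.reverse.slitPlane ↔ (m - x, -y) ∈ C.slitPlane := by
  rw [← not_iff_not, notMem_slitPlane_iff, notMem_slitPlane_iff]
  constructor
  · rintro ⟨v, hv, hx, h⟩
    refine ⟨-v, C.lattice.neg_mem hv, ?_, ?_⟩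
    · simp only [mem_Icc, Prod.fst_neg] at hx ⊢
      constructor <;> linarith [hx.1, hx.2]
    · simp only [top, reverse, Prod.fst_neg, Prod.snd_neg] at h ⊢
      rw [show m - x - -v.1 = m - (x - v.1) by ring]
      linarith
  · rintro ⟨v, hv, hx, h⟩
    refine ⟨-v, C.lattice.neg_mem hv, ?_, ?_⟩
    · simp only [mem_Icc, Prod.fst_neg] at hx ⊢
      constructor <;> linarith [hx.1, hx.2]
    · simp only [top, reverse, Prod.fst_neg, Prod.snd_neg] at h ⊢
      rw [show m - (x - -v.1) = m - x - v.1 by ring]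
      linarith

theorem isIrreducible_reverse (hC : C.IsIrreducible) : C.reverse.IsIrreducible := by
  have hend : ∀ x y, C.reverse.IsEnd (x, y) → C.IsEnd (m - x, -y) := by
    rintro x y ⟨v, hv, h | h⟩
    · refine ⟨-v, C.lattice.neg_mem hv, Or.inr ?_⟩
      simp only [leftEnd, rightEnd, reverse, Prod.ext_iff, Prod.fst_add,
        Prod.snd_add, Prod.fst_neg, Prod.snd_neg, sub_zero] at h ⊢
      exact ⟨by linarith [h.1], by linarith [h.2]⟩
    · refine ⟨-v, C.lattice.neg_mem hv, Or.inl ?_⟩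
      simp only [leftEnd, rightEnd, reverse, Prod.ext_iff, Prod.fst_add,
        Prod.snd_add, Prod.fst_neg, Prod.snd_neg, sub_self] at h ⊢
      exact ⟨by linarith [h.1], by linarith [h.2]⟩
  constructor
  · intro x y₀ y₁ h h0 h1
    refine hC.no_connection (m - x) (-y₁) (-y₀) ⟨by linarith [h.lt], ?_, ?_, ?_⟩
      (hend _ _ h1) (hend _ _ h0)
    · exact fun h' => h.high ((C.mem_reverse_slitPlane_iff _ _).2 h')
    · exact fun h' => h.low ((C.mem_reverse_slitPlane_iff _ _).2 h')
    · intro y hy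
      have := h.clear (-y) ⟨by linarith [hy.2], by linarith [hy.1]⟩
      rwa [mem_reverse_slitPlane_iff, neg_neg] at this
  · intro x w hw hl
    obtain ⟨y, hy⟩ := hC.no_loop (m - x) w hw hl
    refine ⟨-y, ?_⟩
    rwa [mem_reverse_slitPlane_iff, neg_neg]

/-! ### Existence of gaps -/

variable {C}

/-- Every downward trajectory meets the segment: if the lattice has no vertical vector, a multiple of
a steep lattice vector brings the segment under a given point. -/
theorem IsIrreducible.exists_hit_below (hC : C.IsIrreducible) (x y : ℝ) :
    ∃ y' < y, (x, y') ∉ C.slitPlane := by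
  have hm := C.m_pos
  by_cases hvert : ∃ w, (0, w) ∈ C.lattice ∧ w ≠ 0
  · have : ∃ w, 0 < w ∧ (0, w) ∈ C.lattice := by
      obtain ⟨w, hw, hw0⟩ := hvert
      rcases lt_or_gt_of_ne hw0 with h | h
      · exact ⟨-w, by linarith, by simpa using C.lattice.neg_mem hw⟩
      · exact ⟨w, h, hw⟩
    obtain ⟨w, hw, hwl⟩ := this
    obtain ⟨y₁, hy₁⟩ := hC.no_loop x w hw hwl
    obtain ⟨n, hn⟩ := exists_nat_gt ((y₁ - y) / w)
    rw [div_lt_iff₀ hw] at hn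
    refine ⟨y₁ - n * w, by linarith, fun h => hy₁ ?_⟩
    have := (C.add_mem_slitPlane_iff (C.lattice.nsmul_mem hwl n) (x, y₁ - n * w)).2 h
    simpa using this
  · push Not at hvert
    obtain ⟨S, hS, hφ⟩ := C.exists_bound
    obtain ⟨R, hR, hnear⟩ := C.exists_lattice_near
    obtain ⟨g, hg, hg1, -⟩ := hnear (R + m - x, 0)
    obtain ⟨g', hg', hg1', -⟩ := hnear (-R - x, 0)
    obtain ⟨u, hu, hu1, hu2⟩ := C.exists_lattice_high hm (S + |y| + |g.2| + |g'.2|)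
    have hu0 : u.1 ≠ 0 := by
      intro h0
      have h2 := hvert u.2 (by rw [← h0]; exact hu)
      linarith [abs_nonneg y, abs_nonneg g.2, abs_nonneg g'.2]
    simp only at hg1 hg1'
    have b1 := abs_le.1 hg1
    have b2 := abs_le.1 hg1'
    have b3 := abs_le.1 hu1
    -- Adding a positive multiple of `-u` to a shift of the point moves it over the segment.
    suffices h : ∃ e ∈ C.lattice, |e.2| ≤ |g.2| + |g'.2| ∧ ∃ k : ℕ, 1 ≤ k ∧
        x + e.1 + k * u.1 ∈ Icc 0 m by
      obtain ⟨e, he, he2, k, hk, hx⟩ := h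
      have hx' : x - (-(k • u) - e).1 ∈ Icc 0 m := by
        have : x - (-(k • u) - e).1 = x + e.1 + k * u.1 := by simp; ring
        rwa [this]
      refine ⟨_, ?_, C.top_notMem_slitPlane
        (C.lattice.sub_mem (C.lattice.neg_mem (C.lattice.nsmul_mem hu k)) he) hx'⟩
      have c1 := abs_le.1 (hφ _ hx')
      have c2 := abs_le.1 he2
      have c3 : (1 : ℝ) ≤ k := by exact_mod_cast hk
      have c4 : 0 ≤ u.2 := by linarith [abs_nonneg y, abs_nonneg g.2, abs_nonneg g'.2]
      have c5 := mul_le_mul_of_nonneg_right c3 c4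
      simp only [top]
      have : (-(k • u) - e).2 = -(k * u.2) - e.2 := by simp
      rw [this]
      linarith [c1.2, c2.1, neg_abs_le y]
    rcases lt_or_gt_of_ne hu0 with h | h
    · refine ⟨g, hg, by linarith [abs_nonneg g'.2], ⌊(x + g.1) / (-u.1)⌋₊, ?_, ?_⟩
      · refine Nat.le_floor ?_
        rw [le_div_iff₀ (by linarith)]
        push_cast
        linarith [b3.1]
      · have d0 : 0 ≤ (x + g.1) / (-u.1) := div_nonneg (by linarith) (by linarith)
        have d1 := Nat.floor_le d0
        have d2 := Nat.lt_floor_add_one ((x + g.1) / (-u.1))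
        rw [le_div_iff₀ (by linarith)] at d1
        rw [div_lt_iff₀ (by linarith)] at d2
        constructor <;> linarith [b3.1]
    · refine ⟨g', hg', by linarith [abs_nonneg g.2], ⌊-(x + g'.1) / u.1⌋₊ + 1, by omega, ?_⟩
      have d0 : 0 ≤ -(x + g'.1) / u.1 := div_nonneg (by linarith) (by linarith)
      have d1 := Nat.floor_le d0
      have d2 := Nat.lt_floor_add_one (-(x + g'.1) / u.1)
      rw [le_div_iff₀ (by linarith)] at d1
      rw [div_lt_iff₀ (by linarith)] at d2
      push_cast
      constructor <;> linarith [b3.1]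

theorem IsIrreducible.exists_hit_above (hC : C.IsIrreducible) (x y : ℝ) :
    ∃ y', y < y' ∧ (x, y') ∉ C.slitPlane := by
  obtain ⟨y', h1, h2⟩ := (C.isIrreducible_reverse hC).exists_hit_below (m - x) (-y)
  refine ⟨-y', by linarith, ?_⟩
  rwa [mem_reverse_slitPlane_iff, sub_sub_cancel] at h2

theorem IsIrreducible.exists_first_above (hC : C.IsIrreducible) (x y : ℝ) :
    ∃ y', y < y' ∧ (x, y') ∉ C.slitPlane ∧ ∀ t ∈ Ioo y y', (x, t) ∈ C.slitPlane := by
  obtain ⟨Y, hY, hYs⟩ := hC.exists_hit_above x y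
  have hfin : {t | t ∈ Ioc y Y ∧ (x, t) ∉ C.slitPlane}.Finite :=
    (C.finite_hits x y Y).subset fun t ht => ⟨Ioc_subset_Icc_self ht.1, ht.2⟩
  obtain ⟨t, ⟨ht, hts⟩, hmin⟩ := exists_min_image _ id hfin ⟨Y, ⟨hY, le_rfl⟩, hYs⟩
  refine ⟨t, ht.1, hts, fun z hz => ?_⟩
  by_contra hzs
  exact absurd (hmin z ⟨⟨hz.1, hz.2.le.trans ht.2⟩, hzs⟩) (not_le.2 hz.2)

theorem IsIrreducible.exists_first_below (hC : C.IsIrreducible) (x y : ℝ) :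
    ∃ y' < y, (x, y') ∉ C.slitPlane ∧ ∀ t ∈ Ioo y' y, (x, t) ∈ C.slitPlane := by
  obtain ⟨Y, hY, hYs⟩ := hC.exists_hit_below x y
  have hfin : {t | t ∈ Ico Y y ∧ (x, t) ∉ C.slitPlane}.Finite :=
    (C.finite_hits x Y y).subset fun t ht => ⟨Ico_subset_Icc_self ht.1, ht.2⟩
  obtain ⟨t, ⟨ht, hts⟩, hmax⟩ := exists_max_image _ id hfin ⟨Y, ⟨le_rfl, hY⟩, hYs⟩
  refine ⟨t, ht.2, hts, fun z hz => ?_⟩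
  by_contra hzs
  exact absurd (hmax z ⟨⟨ht.1.trans hz.1.le, hz.2⟩, hzs⟩) (not_le.2 hz.1)

end TorusPlane

namespace TorusPlane

variable {m : ℝ} (C : TorusPlane m)

/-! ### First hits of upward trajectories -/

/-- The upward trajectory from the point of the segment over `x` meets the shifts of the segment for
the first time in a point, possibly an end, of the shift by `v`. -/
structure Meets (v : ℝ × ℝ) (x : ℝ) : Prop where
  mem : v ∈ C.lattice
  inner : x ∈ Ioo 0 m
  above : x - v.1 ∈ Icc 0 m
  gap : C.Gap x (C.φ x) (C.top v x)

variable {C}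

theorem Reaches.meets {v : ℝ × ℝ} {x : ℝ} (h : C.Reaches v x) (hv : v ∈ C.lattice) :
    C.Meets v x where
  mem := hv
  inner := h.1
  above := Ioo_subset_Icc_self h.2.1
  gap := ⟨h.2.2.1, C.base_notMem_slitPlane (Ioo_subset_Icc_self h.1),
    C.top_notMem_slitPlane hv (Ioo_subset_Icc_self h.2.1), h.2.2.2⟩

theorem Meets.reaches {v : ℝ × ℝ} {x : ℝ} (h : C.Meets v x) (hx : x - v.1 ∈ Ioo 0 m) :
    C.Reaches v x :=
  ⟨h.inner, hx, h.gap.lt, h.gap.clear⟩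

theorem Meets.unique {u v : ℝ × ℝ} {x : ℝ} (hu : C.Meets u x) (hv : C.Meets v x) : u = v :=
  C.eq_of_top_eq hu.mem hv.mem hu.above hv.above (hu.gap.high_unique hv.gap)

/-- The first return to the segment is injective. -/
theorem Meets.eq_of_sub_eq {u v : ℝ × ℝ} {x x' : ℝ} (hu : C.Meets u x) (hv : C.Meets v x')
    (h : x - u.1 = x' - v.1) : u = v := by
  have g1 := hu.gap.add (C.lattice.neg_mem hu.mem)
  have g2 := hv.gap.add (C.lattice.neg_mem hv.mem)
  simp only [top, Prod.fst_neg, Prod.snd_neg, ← sub_eq_add_neg, add_sub_cancel_right] at g1 g2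
  rw [← h] at g2
  have h0 := g1.low_unique g2
  refine neg_injective (C.eq_of_top_eq (x := x - u.1) (C.lattice.neg_mem hu.mem)
    (C.lattice.neg_mem hv.mem) ?_ ?_ ?_)
  · simpa using Ioo_subset_Icc_self hu.inner
  · rw [h]; simpa using Ioo_subset_Icc_self hv.inner
  · simp only [top, Prod.fst_neg, Prod.snd_neg]
    rw [show x - u.1 - -u.1 = x by ring, show x - u.1 - -v.1 = x' by rw [h]; ring]
    linarith

variable (C) in
/-- The continuous extension of `top v` to the whole line. -/
noncomputable def topExt (v : ℝ × ℝ) (x : ℝ) : ℝ := C.ext (x - v.1) + v.2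

variable (C) in
theorem topExt_continuous (v : ℝ × ℝ) : Continuous (C.topExt v) :=
  (C.ext_continuous.comp (continuous_id.sub continuous_const)).add continuous_const

variable (C) in
theorem topExt_eq {v : ℝ × ℝ} {x : ℝ} (hx : x - v.1 ∈ Icc 0 m) : C.topExt v x = C.top v x := by
  rw [topExt, C.ext_eq hx, top]

/-- If a trajectory first meets the shift by `v`, then so do all nearby trajectories over which this
shift extends. -/
theorem Meets.eventually_reaches {v : ℝ × ℝ} {x : ℝ} (h : C.Meets v x) :
    ∀ᶠ x' in 𝓝 x, x' - v.1 ∈ Ioo 0 m → C.Reaches v x' := by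
  have hxI := Ioo_subset_Icc_self h.inner
  have e0 : C.ext x = C.φ x := C.ext_eq hxI
  have e1 : C.topExt v x = C.top v x := C.topExt_eq h.above
  have hfin := C.finite_near x 1 (C.φ x - 1) (C.top v x + 1)
  have hw : ∀ w ∈ {w | w ∈ C.lattice ∧ ∃ x' ∈ Icc (x - 1) (x + 1),
      x' - w.1 ∈ Icc 0 m ∧ C.top w x' ∈ Icc (C.φ x - 1) (C.top v x + 1)},
      ∀ᶠ x' in 𝓝 x, w ≠ 0 → w ≠ v → x' - w.1 ∈ Icc 0 m →
        C.top w x' ∉ Icc (C.ext x') (C.topExt v x') := by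
    rintro w ⟨hwL, -⟩
    by_cases hxw : x - w.1 ∈ Icc 0 m
    · have e2 : C.topExt w x = C.top w x := C.topExt_eq hxw
      by_cases h0 : w = 0
      · exact Eventually.of_forall fun _ h => absurd h0 h
      by_cases h1 : w = v
      · exact Eventually.of_forall fun _ _ h => absurd h1 h
      have hs := C.top_notMem_slitPlane hwL hxw
      rcases lt_trichotomy (C.top w x) (C.φ x) with hlt | heq | hgt
      · rw [← e0, ← e2] at hlt
        filter_upwards [(C.topExt_continuous w).continuousAt.eventually_lt
          C.ext_continuous.continuousAt hlt] with x' hx' _ _ hin hc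
        rw [C.topExt_eq hin] at hx'
        exact absurd hc.1 (not_le.2 hx')
      · rw [← C.top_zero] at heq
        exact absurd (C.eq_of_top_eq hwL C.lattice.zero_mem hxw (by simpa using hxI) heq) h0
      · rcases lt_trichotomy (C.top w x) (C.top v x) with hlt' | heq' | hgt'
        · exact absurd (h.gap.clear _ ⟨hgt, hlt'⟩) hs
        · exact absurd (C.eq_of_top_eq hwL h.mem hxw h.above heq') h1
        · rw [← e1, ← e2] at hgt'
          filter_upwards [(C.topExt_continuous v).continuousAt.eventually_lt
            (C.topExt_continuous w).continuousAt hgt'] with x' hx' _ _ hin hc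
          rw [C.topExt_eq hin] at hx'
          exact absurd hc.2 (not_le.2 hx')
    · have hop : IsOpen {x' : ℝ | x' - w.1 ∉ Icc 0 m} :=
        (isClosed_Icc.preimage (continuous_id.sub continuous_const)).isOpen_compl
      filter_upwards [hop.mem_nhds hxw] with x' hx' _ _ hin
      exact absurd hin hx'
  have h3 : C.ext x < C.topExt v x := by rw [e0, e1]; exact h.gap.lt
  filter_upwards [(eventually_all_finite hfin).2 hw,
    Icc_mem_nhds (show x - 1 < x by linarith) (show x < x + 1 by linarith),
    Ioo_mem_nhds h.inner.1 h.inner.2,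
    C.ext_continuous.continuousAt.eventually_lt (C.topExt_continuous v).continuousAt h3,
    C.ext_continuous.continuousAt.eventually_const_lt (show C.φ x - 1 < C.ext x by linarith),
    (C.topExt_continuous v).continuousAt.eventually_lt_const
      (show C.topExt v x < C.top v x + 1 by linarith)]
    with x' hall hx1 hx'I hlt hlo hhi hxv
  have f0 : C.ext x' = C.φ x' := C.ext_eq (Ioo_subset_Icc_self hx'I)
  have f1 : C.topExt v x' = C.top v x' := C.topExt_eq (Ioo_subset_Icc_self hxv)
  rw [f0, f1] at hlt hall
  rw [f0] at hlo
  rw [f1] at hhi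
  refine ⟨hx'I, hxv, hlt, fun y hy => ?_⟩
  by_contra hs
  obtain ⟨w, hwL, hxw, rfl⟩ := C.notMem_slitPlane_iff.1 hs
  refine hall w ⟨hwL, x', hx1, hxw, by linarith [hy.1], by linarith [hy.2]⟩ ?_ ?_ hxw
    ⟨hy.1.le, hy.2.le⟩
  · rintro rfl
    rw [top_zero] at hy
    exact lt_irrefl _ hy.1
  · rintro rfl
    exact lt_irrefl _ hy.2

/-- Over an interval without cuts all trajectories meet the same shift, since the sets of
trajectories that meet different shifts are open and disjoint. -/
theorem exists_reaches_const {c d : ℝ} (hcd : c < d)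
    (h : ∀ x ∈ Ioo c d, ∃ v ∈ C.lattice, C.Reaches v x) :
    ∃ v ∈ C.lattice, ∀ x ∈ Ioo c d, C.Reaches v x := by
  have hop : ∀ v ∈ C.lattice, IsOpen {x | C.Reaches v x} := by
    intro v hv
    rw [isOpen_iff_mem_nhds]
    intro x hx
    have hI : ∀ᶠ x' in 𝓝 x, x' - v.1 ∈ Ioo 0 m :=
      (isOpen_Ioo.preimage (continuous_id.sub continuous_const)).mem_nhds hx.2.1
    filter_upwards [(hx.meets hv).eventually_reaches, hI] with x' h1 h2
    exact h1 h2
  obtain ⟨x₀, hx₀⟩ := exists_between hcd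
  obtain ⟨v, hv, hvx⟩ := h x₀ hx₀
  refine ⟨v, hv, ?_⟩
  refine isPreconnected_Ioo.subset_left_of_subset_union (u := {x | C.Reaches v x}) (hop v hv)
    (isOpen_biUnion (s := {u | u ∈ C.lattice ∧ u ≠ v}) fun u hu => hop u hu.1) ?_ ?_
    ⟨x₀, hx₀, hvx⟩
  · rw [disjoint_left]
    intro x hx hx'
    simp only [mem_iUnion] at hx'
    obtain ⟨u, hu, hux⟩ := hx'
    exact hu.2 ((Reaches.meets hux hu.1).unique (Reaches.meets hx hv))
  · intro x hx
    obtain ⟨u, hu, hux⟩ := h x hx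
    by_cases huv : u = v
    · exact Or.inl (huv ▸ hux)
    · exact Or.inr (mem_biUnion (show u ∈ {u | u ∈ C.lattice ∧ u ≠ v} from ⟨hu, huv⟩) hux)

/-! ### The two cuts -/

theorem isEnd_or_inner {x y : ℝ} (h : (x, y) ∉ C.slitPlane) :
    C.IsEnd (x, y) ∨ ∃ v ∈ C.lattice, x - v.1 ∈ Ioo 0 m ∧ y = C.top v x := by
  obtain ⟨v, hv, hx, rfl⟩ := C.notMem_slitPlane_iff.1 h
  rcases hx.1.eq_or_lt with h0 | h0
  · refine Or.inl ⟨v, hv, Or.inl (Prod.ext ?_ ?_)⟩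
    · simp [leftEnd]; linarith
    · simp [leftEnd, top, ← h0]
  rcases hx.2.eq_or_lt with h1 | h1
  · refine Or.inl ⟨v, hv, Or.inr (Prod.ext ?_ ?_)⟩
    · simp [rightEnd]; linarith
    · simp [rightEnd, top, h1]
  exact Or.inr ⟨v, hv, ⟨h0, h1⟩, rfl⟩

variable (C) in
/-- `g₁` is the shift whose right end, and `g₂` the shift whose left end, is visible from the inner
points of the segment: the trajectories over `m + g₁.1` and `g₂.1` run into these ends. -/
structure Cuts (g₁ g₂ : ℝ × ℝ) : Prop where
  meets₁ : C.Meets g₁ (m + g₁.1)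
  meets₂ : C.Meets g₂ g₂.1

/-- Below an end of the segment there is an inner point of a shift; after the opposite shift, the end
is seen from the segment itself. -/
theorem IsIrreducible.exists_meets (hC : C.IsIrreducible) {e : ℝ} (he : e ∈ Icc 0 m)
    (hend : C.IsEnd (e, C.φ e)) : ∃ g, C.Meets g (e + g.1) := by
  obtain ⟨y, hy, hys, hclear⟩ := hC.exists_first_below e (C.φ e)
  have hgap : C.Gap e y (C.φ e) := ⟨hy, hys, C.base_notMem_slitPlane he, hclear⟩
  rcases isEnd_or_inner hys with h | ⟨v, hv, hev, rfl⟩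
  · exact (hC.no_connection _ _ _ hgap h hend).elim
  · have hg := hgap.add (C.lattice.neg_mem hv)
    refine ⟨-v, C.lattice.neg_mem hv, by simpa [← sub_eq_add_neg] using hev, by simpa using he, ?_⟩
    have e1 : C.top v e + (-v).2 = C.φ (e + (-v).1) := by simp [top, ← sub_eq_add_neg]
    have e2 : C.φ e + (-v).2 = C.top (-v) (e + (-v).1) := by simp [top]
    rwa [← e1, ← e2]

variable (C) in
theorem isEnd_left : C.IsEnd (0, C.φ 0) := ⟨0, C.lattice.zero_mem, Or.inl (by simp [leftEnd])⟩

variable (C) in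
theorem isEnd_right : C.IsEnd (m, C.φ m) := ⟨0, C.lattice.zero_mem, Or.inr (by simp [rightEnd])⟩

theorem IsIrreducible.exists_cuts (hC : C.IsIrreducible) : ∃ g₁ g₂, C.Cuts g₁ g₂ := by
  obtain ⟨g₁, h₁⟩ := hC.exists_meets (right_mem_Icc.2 C.m_pos.le) C.isEnd_right
  obtain ⟨g₂, h₂⟩ := hC.exists_meets (left_mem_Icc.2 C.m_pos.le) C.isEnd_left
  exact ⟨g₁, g₂, h₁, by rwa [zero_add] at h₂⟩

theorem Cuts.exists_reaches (hC : C.IsIrreducible) {g₁ g₂ : ℝ × ℝ} (hg : C.Cuts g₁ g₂) {x : ℝ}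
    (hx : x ∈ Ioo 0 m) (h₁ : x ≠ m + g₁.1) (h₂ : x ≠ g₂.1) :
    ∃ v ∈ C.lattice, C.Reaches v x := by
  obtain ⟨y, hy, hys, hclear⟩ := hC.exists_first_above x (C.φ x)
  obtain ⟨v, hv, hxv, rfl⟩ := C.notMem_slitPlane_iff.1 hys
  have hM : C.Meets v x :=
    ⟨hv, hx, hxv, hy, C.base_notMem_slitPlane (Ioo_subset_Icc_self hx), hys, hclear⟩
  refine ⟨v, hv, hM.reaches ⟨lt_of_le_of_ne hxv.1 fun h => h₂ ?_,
    lt_of_le_of_ne hxv.2 fun h => h₁ ?_⟩⟩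
  · rw [← hM.eq_of_sub_eq hg.meets₂ (by linarith)]; linarith
  · rw [← hM.eq_of_sub_eq hg.meets₁ (by linarith)]; linarith

/-- To the left of the first cut the trajectories meet the shift by `g₁`. -/
theorem Cuts.eventually_left {g₁ g₂ : ℝ × ℝ} (hg : C.Cuts g₁ g₂) :
    ∀ᶠ x in 𝓝[<] (m + g₁.1), C.Reaches g₁ x := by
  have h0 : g₁.1 < m + g₁.1 := by linarith [C.m_pos]
  filter_upwards [hg.meets₁.eventually_reaches.filter_mono nhdsWithin_le_nhds,
    Ioo_mem_nhdsLT h0] with x h1 h2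
  exact h1 ⟨by linarith [h2.1], by linarith [h2.2]⟩

theorem Cuts.eventually_right {g₁ g₂ : ℝ × ℝ} (hg : C.Cuts g₁ g₂) :
    ∀ᶠ x in 𝓝[>] g₂.1, C.Reaches g₂ x := by
  have h0 : g₂.1 < m + g₂.1 := by linarith [C.m_pos]
  filter_upwards [hg.meets₂.eventually_reaches.filter_mono nhdsWithin_le_nhds,
    Ioo_mem_nhdsGT h0] with x h1 h2
  exact h1 ⟨by linarith [h2.1], by linarith [h2.2]⟩

theorem eq_of_eventually {u v : ℝ × ℝ} {F : Filter ℝ} [F.NeBot] (hu : u ∈ C.lattice)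
    (hv : v ∈ C.lattice) (h1 : ∀ᶠ x in F, C.Reaches u x) (h2 : ∀ᶠ x in F, C.Reaches v x) :
    u = v := by
  obtain ⟨x, hx1, hx2⟩ := (h1.and h2).exists
  exact (hx1.meets hu).unique (hx2.meets hv)

/-- The cut under a right end lies to the left of the cut under a left end: otherwise one shift would
have both its ends on the walls of the middle strip, which is narrower than the segment. -/
theorem Cuts.lt (hC : C.IsIrreducible) {g₁ g₂ : ℝ × ℝ} (hg : C.Cuts g₁ g₂) :
    m + g₁.1 < g₂.1 := by
  have i1 := hg.meets₁.inner
  have i2 := hg.meets₂.inner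
  rcases lt_trichotomy (m + g₁.1) g₂.1 with h | h | h
  · exact h
  · have := (h ▸ hg.meets₁).unique hg.meets₂
    rw [this] at h
    linarith [C.m_pos]
  · obtain ⟨v, hv, hall⟩ := exists_reaches_const h fun x hx =>
      hg.exists_reaches hC ⟨i2.1.trans hx.1, hx.2.trans i1.2⟩ hx.2.ne hx.1.ne'
    have e1 := eq_of_eventually hv hg.meets₁.mem
      (mem_of_superset (Ioo_mem_nhdsLT h) hall) hg.eventually_left
    have e2 := eq_of_eventually hv hg.meets₂.mem
      (mem_of_superset (Ioo_mem_nhdsGT h) hall) hg.eventually_right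
    have : g₁ = g₂ := e1 ▸ e2
    rw [this] at i1
    linarith [i1.2, i2.1]

variable (C) in
/-- The first return to the segment: the trajectories to the left of both cuts, between the cuts and
to the right of the cuts end on the shifts by `g₁`, `g₀` and `g₂`. -/
structure StreetData (g₀ g₁ g₂ : ℝ × ℝ) : Prop extends C.Cuts g₁ g₂ where
  mem₀ : g₀ ∈ C.lattice
  lt : m + g₁.1 < g₂.1
  reaches₀ : ∀ x ∈ Ioo (m + g₁.1) g₂.1, C.Reaches g₀ x
  reaches₁ : ∀ x ∈ Ioo 0 (m + g₁.1), C.Reaches g₁ x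
  reaches₂ : ∀ x ∈ Ioo g₂.1 m, C.Reaches g₂ x

theorem IsIrreducible.exists_streetData (hC : C.IsIrreducible) :
    ∃ g₀ g₁ g₂, C.StreetData g₀ g₁ g₂ := by
  obtain ⟨g₁, g₂, hg⟩ := hC.exists_cuts
  have hlt := hg.lt hC
  have i1 := hg.meets₁.inner
  have i2 := hg.meets₂.inner
  obtain ⟨g₀, h0, hall0⟩ := exists_reaches_const hlt fun x hx =>
    hg.exists_reaches hC ⟨i1.1.trans hx.1, hx.2.trans i2.2⟩ hx.1.ne' hx.2.ne
  obtain ⟨v₁, h1, hall1⟩ := exists_reaches_const i1.1 fun x hx =>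
    hg.exists_reaches hC ⟨hx.1, hx.2.trans i1.2⟩ hx.2.ne (hx.2.trans hlt).ne
  obtain ⟨v₂, h2, hall2⟩ := exists_reaches_const i2.2 fun x hx =>
    hg.exists_reaches hC ⟨i2.1.trans hx.1, hx.2⟩ (hlt.trans hx.1).ne' hx.1.ne'
  have e1 := eq_of_eventually h1 hg.meets₁.mem
    (mem_of_superset (Ioo_mem_nhdsLT i1.1) hall1) hg.eventually_left
  have e2 := eq_of_eventually h2 hg.meets₂.mem
    (mem_of_superset (Ioo_mem_nhdsGT i2.2) hall2) hg.eventually_right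
  exact ⟨g₀, g₁, g₂, hg, h0, hlt, hall0, e1 ▸ hall1, e2 ▸ hall2⟩

namespace StreetData

variable {g₀ g₁ g₂ : ℝ × ℝ}

/-- The transversal part of the relation between the heights: the first return maps the three
intervals to disjoint intervals which fill the segment in the opposite order. -/
theorem fst_add (hD : C.StreetData g₀ g₁ g₂) : g₁.1 + g₂.1 = g₀.1 := by
  have i1 := hD.meets₁.inner
  have i2 := hD.meets₂.inner
  have key : ∀ x ∈ Ioo (m + g₁.1) g₂.1, m - g₂.1 ≤ x - g₀.1 ∧ x - g₀.1 ≤ -g₁.1 := by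
    intro x hx
    have hr := hD.reaches₀ x hx
    constructor <;> by_contra! hlt
    · have h := (hr.meets hD.mem₀).eq_of_sub_eq ((hD.reaches₂ (x - g₀.1 + g₂.1)
        ⟨by linarith [hr.2.1.1], by linarith⟩).meets hD.meets₂.mem) (by ring)
      subst h
      linarith [hx.2, hr.2.1.1]
    · have h := (hr.meets hD.mem₀).eq_of_sub_eq ((hD.reaches₁ (x - g₀.1 + g₁.1)
        ⟨by linarith, by linarith [hr.2.1.2]⟩).meets hD.meets₁.mem) (by ring)
      subst h
      linarith [hx.1, hr.2.1.2]
  have h1 : g₁.1 + g₂.1 ≤ g₀.1 := by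
    by_contra! hlt
    obtain ⟨x, hx1, hx2⟩ := exists_between (max_lt hD.lt (show g₀.1 - g₁.1 < g₂.1 by linarith))
    linarith [(key x ⟨(le_max_left _ _).trans_lt hx1, hx2⟩).2,
      (le_max_right (m + g₁.1) (g₀.1 - g₁.1)).trans_lt hx1]
  have h2 : g₀.1 ≤ g₁.1 + g₂.1 := by
    by_contra! hlt
    obtain ⟨x, hx1, hx2⟩ := exists_between
      (lt_min hD.lt (show m + g₁.1 < g₀.1 + m - g₂.1 by linarith))
    linarith [(key x ⟨hx1, hx2.trans_le (min_le_left _ _)⟩).1,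
      hx2.trans_le (min_le_right g₂.1 (g₀.1 + m - g₂.1))]
  exact le_antisymm h1 h2

/-- The closed strip between the cuts: over its walls the upper side lies above the lower one. -/
theorem base_lt_top (hD : C.StreetData g₀ g₁ g₂) {x : ℝ} (hx : x ∈ Icc (m + g₁.1) g₂.1) :
    C.φ x < C.top g₀ x := by
  have i1 := hD.meets₁.inner
  have i2 := hD.meets₂.inner
  have hs := hD.fst_add
  have hxm : x ∈ Icc 0 m := ⟨i1.1.le.trans hx.1, hx.2.trans i2.2.le⟩
  have hx0 : x - g₀.1 ∈ Icc 0 m := ⟨by linarith [hx.1, i2.2], by linarith [hx.2, i1.1]⟩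
  have hle : C.ext x ≤ C.topExt g₀ x := by
    have hcl : IsClosed {x | C.ext x ≤ C.topExt g₀ x} :=
      isClosed_le C.ext_continuous (C.topExt_continuous g₀)
    have hsub : Ioo (m + g₁.1) g₂.1 ⊆ {x | C.ext x ≤ C.topExt g₀ x} := by
      intro t ht
      have hr := hD.reaches₀ t ht
      rw [mem_ofPred_eq, C.ext_eq (Ioo_subset_Icc_self hr.1),
        C.topExt_eq (Ioo_subset_Icc_self hr.2.1)]
      exact hr.2.2.1.le
    have := closure_minimal hsub hcl
    rw [closure_Ioo hD.lt.ne] at this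
    exact this hx
  rw [C.ext_eq hxm, C.topExt_eq hx0] at hle
  refine lt_of_le_of_ne hle fun h => ?_
  rw [← C.top_zero] at h
  have h0 := C.eq_of_top_eq C.lattice.zero_mem hD.mem₀ (by simpa using hxm) hx0 h
  obtain ⟨t, ht⟩ := exists_between hD.lt
  have := (hD.reaches₀ t ht).2.2.1
  rw [← h0, C.top_zero] at this
  exact lt_irrefl _ this

/-- An end of a shift seen from a point over a wall of the middle strip lies below the upper
side of the strip. -/
theorem top_lt_top (hD : C.StreetData g₀ g₁ g₂) {x : ℝ} (hx : x ∈ Icc (m + g₁.1) g₂.1)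
    {g : ℝ × ℝ} (hg : C.Meets g x) (hne : g ≠ g₀) : C.top g x < C.top g₀ x := by
  have i1 := hD.meets₁.inner
  have i2 := hD.meets₂.inner
  have hs := hD.fst_add
  have hx0 : x - g₀.1 ∈ Icc 0 m := ⟨by linarith [hx.1, i2.2], by linarith [hx.2, i1.1]⟩
  by_contra! hle
  rcases hle.eq_or_lt with h | h
  · exact hne (C.eq_of_top_eq hD.mem₀ hg.mem hx0 hg.above h).symm
  · exact C.top_notMem_slitPlane hD.mem₀ hx0 (hg.gap.clear _ ⟨hD.base_lt_top hx, h⟩)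

/-- The relation between the heights: `g₁` and `g₀ - g₂` both put the right end of the segment on the
left wall of the middle strip, and there is only one such end since otherwise two consecutive ones
would be connected. -/
theorem add_eq (hC : C.IsIrreducible) (hD : C.StreetData g₀ g₁ g₂) : g₁ + g₂ = g₀ := by
  have i1 := hD.meets₁.inner
  have i2 := hD.meets₂.inner
  have hs := hD.fst_add
  have hm := C.m_pos
  set x₀ := m + g₁.1 with hx₀
  have hwall : x₀ ∈ Icc x₀ g₂.1 := left_mem_Icc.2 hD.lt.le
  set w := g₀ - g₂ with hw
  have hwL : w ∈ C.lattice := C.lattice.sub_mem hD.mem₀ hD.meets₂.mem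
  have hw1 : w.1 = g₁.1 := by simp [hw]; linarith
  have hx0 : x₀ - g₀.1 ∈ Icc 0 m := ⟨by linarith [i2.2], by linarith [hD.lt, i1.1]⟩
  have hxw : x₀ - w.1 ∈ Icc 0 m := ⟨by rw [hw1]; linarith, by rw [hw1]; linarith⟩
  have hxI : x₀ ∈ Icc 0 m := Ioo_subset_Icc_self i1
  -- The street over the right part of the segment, shifted by `w`, is adjacent to the wall.
  have hgap : ∀ x ∈ Ioo (g₂.1 + w.1) x₀, C.Gap x (C.top w x) (C.top g₀ x) := by
    intro x hx
    have h := ((hD.reaches₂ (x - w.1) ⟨by linarith [hx.1], by linarith [hx.2]⟩).meets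
      hD.meets₂.mem).gap.add hwL
    have e1 : C.top g₂ (x - w.1) + w.2 = C.top g₀ x := by
      rw [← C.top_add, sub_add_cancel, hw, add_sub_cancel]
    rwa [sub_add_cancel, e1] at h
  have hlt0 : g₂.1 + w.1 < x₀ := by linarith [i2.2]
  have hev := Ioo_mem_nhdsLT hlt0
  have hevI : ∀ᶠ x in 𝓝[<] x₀, x ∈ Ioo 0 m :=
    mem_nhdsWithin_of_mem_nhds (Ioo_mem_nhds i1.1 i1.2)
  have htw : C.top w x₀ < C.top g₀ x₀ := by
    have hle : C.topExt w x₀ ≤ C.topExt g₀ x₀ := by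
      refine le_of_tendsto_of_tendsto
        ((C.topExt_continuous w).continuousAt.tendsto.mono_left nhdsWithin_le_nhds)
        ((C.topExt_continuous g₀).continuousAt.tendsto.mono_left nhdsWithin_le_nhds)
        (b := 𝓝[<] x₀) ?_
      filter_upwards [hev] with x hx
      rw [C.topExt_eq ⟨by linarith [hx.1, i2.1], by linarith [hx.2]⟩,
        C.topExt_eq ⟨by linarith [hx.1], by linarith [hx.2, hx0.2]⟩]
      exact (hgap x hx).lt.le
    rw [C.topExt_eq hxw, C.topExt_eq hx0] at hle
    refine lt_of_le_of_ne hle fun h => ?_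
    have := C.eq_of_top_eq hwL hD.mem₀ hxw hx0 h
    rw [this] at hw1
    linarith [i2.1]
  have hbw : C.φ x₀ < C.top w x₀ := by
    by_contra! hle
    rcases hle.eq_or_lt with h | h
    · rw [← C.top_zero] at h
      have := C.eq_of_top_eq hwL C.lattice.zero_mem hxw (by simpa using hxI) h
      rw [this] at hw1
      simp only [Prod.fst_zero] at hw1
      linarith [i1.2]
    · have h1 : ∀ᶠ x in 𝓝[<] x₀, C.topExt w x < C.ext x := by
        refine ((C.topExt_continuous w).continuousAt.eventually_lt C.ext_continuous.continuousAt
          ?_).filter_mono nhdsWithin_le_nhds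
        rwa [C.topExt_eq hxw, C.ext_eq hxI]
      have h2 : ∀ᶠ x in 𝓝[<] x₀, C.ext x < C.topExt g₀ x := by
        refine (C.ext_continuous.continuousAt.eventually_lt (C.topExt_continuous g₀).continuousAt
          ?_).filter_mono nhdsWithin_le_nhds
        rw [C.topExt_eq hx0, C.ext_eq hxI]
        exact hD.base_lt_top hwall
      obtain ⟨x, ha, hb, hx, hxm⟩ := (h1.and (h2.and (Filter.Eventually.and hev hevI))).exists
      rw [C.ext_eq (Ioo_subset_Icc_self hxm)] at ha hb
      rw [C.topExt_eq ⟨by linarith [hx.1, i2.1], by linarith [hx.2]⟩] at ha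
      rw [C.topExt_eq ⟨by linarith [hx.1], by linarith [hx.2, hx0.2]⟩] at hb
      exact C.base_notMem_slitPlane (Ioo_subset_Icc_self hxm) ((hgap x hx).clear _ ⟨ha, hb⟩)
  suffices h : C.top g₁ x₀ = C.top w x₀ by
    have := C.eq_of_top_eq hD.meets₁.mem hwL hD.meets₁.above hxw h
    rw [this, hw, sub_add_cancel]
  rcases lt_trichotomy (C.top g₁ x₀) (C.top w x₀) with h | h | h
  · exfalso
    obtain ⟨y, hy, hys, hclear⟩ := hC.exists_first_above x₀ (C.top g₁ x₀)
    have hG : C.Gap x₀ (C.top g₁ x₀) y := ⟨hy, hD.meets₁.gap.high, hys, hclear⟩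
    have hyw : y ≤ C.top w x₀ := by
      by_contra! hlt
      exact C.top_notMem_slitPlane hwL hxw (hclear _ ⟨h, hlt⟩)
    obtain ⟨u, hu, hxu, rfl⟩ := C.notMem_slitPlane_iff.1 hys
    have hend₁ : C.IsEnd (x₀, C.top g₁ x₀) :=
      ⟨g₁, hD.meets₁.mem, Or.inr (Prod.ext (by simp [rightEnd, hx₀]) (by simp [rightEnd, top, hx₀]))⟩
    refine hC.no_connection _ _ _ hG hend₁ ⟨u, hu, Or.inr ?_⟩
    -- A shift that extends to the right of the wall would cross the middle strip.
    suffices hend : x₀ - u.1 = m from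
      Prod.ext (by simp [rightEnd, ← hend]) (by simp [rightEnd, top, hend])
    by_contra hne
    have hlt := lt_of_le_of_ne hxu.2 hne
    have h1 : ∀ᶠ x in 𝓝[>] x₀, C.ext x < C.topExt u x := by
      refine (C.ext_continuous.continuousAt.eventually_lt (C.topExt_continuous u).continuousAt
        ?_).filter_mono nhdsWithin_le_nhds
      rw [C.topExt_eq hxu, C.ext_eq hxI]
      exact hD.meets₁.gap.lt.trans hy
    have h2 : ∀ᶠ x in 𝓝[>] x₀, C.topExt u x < C.topExt g₀ x := by
      refine ((C.topExt_continuous u).continuousAt.eventually_lt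
        (C.topExt_continuous g₀).continuousAt ?_).filter_mono nhdsWithin_le_nhds
      rw [C.topExt_eq hxu, C.topExt_eq hx0]
      exact hyw.trans_lt htw
    obtain ⟨x, ha, hb, hx, hxu'⟩ := (h1.and (h2.and (Filter.Eventually.and
      (Ioo_mem_nhdsGT hD.lt) (Ioo_mem_nhdsGT (show x₀ < m + u.1 by linarith))))).exists
    have hr := hD.reaches₀ x hx
    have hxu2 : x - u.1 ∈ Icc 0 m := ⟨by linarith [hx.1, hxu.1], by linarith [hxu'.2]⟩
    rw [C.topExt_eq hxu2] at ha hb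
    rw [C.ext_eq (Ioo_subset_Icc_self hr.1)] at ha
    rw [C.topExt_eq (Ioo_subset_Icc_self hr.2.1)] at hb
    exact C.top_notMem_slitPlane hu hxu2 (hr.2.2.2 _ ⟨ha, hb⟩)
  · exact h
  · exact absurd (hD.meets₁.gap.clear _ ⟨hbw, h⟩) (C.top_notMem_slitPlane hwL hxw)

end StreetData

end TorusPlane

namespace TorusPlane

variable {m : ℝ} {C : TorusPlane m}

/-! ### The three streets -/

theorem exists_mem_Ioo_of_ne {a b x : ℝ} (hx : x ∈ Ioo 0 m) (ha : x ≠ a) (hb : x ≠ b) :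
    ∃ τ : Fin 3, x ∈ Ioo (![a, 0, b] τ) (![b, a, m] τ) := by
  rcases lt_or_gt_of_ne ha with h | h
  · exact ⟨1, hx.1, h⟩
  rcases lt_or_gt_of_ne hb with h' | h'
  · exact ⟨0, h, h'⟩
  · exact ⟨2, h', hx.2⟩

namespace StreetData

variable {g₀ g₁ g₂ : ℝ × ℝ}

theorem isStrip (hD : C.StreetData g₀ g₁ g₂) (τ : Fin 3) :
    C.IsStrip (![g₀, g₁, g₂] τ) (![m + g₁.1, 0, g₂.1] τ) (![g₂.1, m + g₁.1, m] τ) := by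
  fin_cases τ
  · exact ⟨hD.mem₀, hD.lt, hD.reaches₀⟩
  · exact ⟨hD.meets₁.mem, hD.meets₁.inner.1, hD.reaches₁⟩
  · exact ⟨hD.meets₂.mem, hD.meets₂.inner.2, hD.reaches₂⟩

theorem not_reaches₁ (hD : C.StreetData g₀ g₁ g₂) {v : ℝ × ℝ} (hv : v ∈ C.lattice) :
    ¬ C.Reaches v (m + g₁.1) := by
  intro h
  have := (h.meets hv).unique hD.meets₁
  subst this
  linarith [h.2.1.2]

theorem not_reaches₂ (hD : C.StreetData g₀ g₁ g₂) {v : ℝ × ℝ} (hv : v ∈ C.lattice) :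
    ¬ C.Reaches v g₂.1 := by
  intro h
  have := (h.meets hv).unique hD.meets₂
  subst this
  linarith [h.2.1.1]

theorem not_reaches_left (hD : C.StreetData g₀ g₁ g₂) {v : ℝ × ℝ} (hv : v ∈ C.lattice)
    (τ : Fin 3) : ¬ C.Reaches v (![m + g₁.1, 0, g₂.1] τ) := by
  fin_cases τ
  · exact hD.not_reaches₁ hv
  · exact fun h => lt_irrefl _ h.1.1
  · exact hD.not_reaches₂ hv

theorem not_reaches_right (hD : C.StreetData g₀ g₁ g₂) {v : ℝ × ℝ} (hv : v ∈ C.lattice)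
    (τ : Fin 3) : ¬ C.Reaches v (![g₂.1, m + g₁.1, m] τ) := by
  fin_cases τ
  · exact hD.not_reaches₂ hv
  · exact hD.not_reaches₁ hv
  · exact fun h => lt_irrefl _ h.1.2

theorem isStreet_iff (hD : C.StreetData g₀ g₁ g₂) (v : ℝ × ℝ) (c d : ℝ) :
    C.IsStreet v c d ↔ ∃ τ, v = ![g₀, g₁, g₂] τ ∧ c = ![m + g₁.1, 0, g₂.1] τ ∧
      d = ![g₂.1, m + g₁.1, m] τ := by
  constructor
  · rintro ⟨⟨hv, hcd, hall⟩, hmax⟩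
    obtain ⟨x, hx⟩ := exists_between hcd
    have hr := hall x hx
    obtain ⟨τ, hτ⟩ := exists_mem_Ioo_of_ne (a := m + g₁.1) (b := g₂.1) hr.1
      (fun h => hD.not_reaches₁ hv (h ▸ hr))
      (fun h => hD.not_reaches₂ hv (h ▸ hr))
    have hs := hD.isStrip τ
    have hvτ := (hr.meets hv).unique ((hs.2.2 x hτ).meets hs.1)
    refine ⟨τ, hvτ, ?_⟩
    have hc : ![m + g₁.1, 0, g₂.1] τ ≤ c := by
      by_contra! hlt
      exact hD.not_reaches_left hv τ (hall _ ⟨hlt, hτ.1.trans hx.2⟩)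
    have hd : d ≤ ![g₂.1, m + g₁.1, m] τ := by
      by_contra! hlt
      exact hD.not_reaches_right hv τ (hall _ ⟨hx.1.trans hτ.2, hlt⟩)
    have := hmax _ _ hc hd (hvτ ▸ hs)
    exact ⟨this.1.symm, this.2.symm⟩
  · rintro ⟨τ, rfl, rfl, rfl⟩
    have hs := hD.isStrip τ
    refine ⟨hs, fun c' d' hc hd ⟨hv, _, hall⟩ => ⟨hc.antisymm ?_, le_antisymm ?_ hd⟩⟩
    · by_contra! hlt
      exact hD.not_reaches_left hv τ (hall _ ⟨hlt, hs.2.1.trans_le hd⟩)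
    · by_contra! hlt
      exact hD.not_reaches_right hv τ (hall _ ⟨hc.trans_lt hs.2.1, hlt⟩)

end StreetData

/-! ### The fundamental domain -/

theorem IsStrip.gap {v : ℝ × ℝ} {c d : ℝ} (hs : C.IsStrip v c d) {p : ℝ × ℝ}
    (hp : p ∈ C.region v c d) : C.Gap p.1 (C.φ p.1) (C.top v p.1) :=
  ((hs.2.2 p.1 hp.1).meets hs.1).gap

theorem IsStrip.isOpen_region {v : ℝ × ℝ} {c d : ℝ} (hs : C.IsStrip v c d) :
    IsOpen (C.region v c d) := by
  have h : C.region v c d =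
      {p | p.1 ∈ Ioo c d} ∩ ({p | C.ext p.1 < p.2} ∩ {p | p.2 < C.topExt v p.1}) := by
    ext p
    constructor
    · rintro ⟨hp, h1, h2⟩
      have hr := hs.2.2 _ hp
      refine ⟨hp, ?_, ?_⟩
      · rwa [mem_ofPred_eq, C.ext_eq (Ioo_subset_Icc_self hr.1)]
      · rwa [mem_ofPred_eq, C.topExt_eq (Ioo_subset_Icc_self hr.2.1)]
    · rintro ⟨hp, h1, h2⟩
      have hr := hs.2.2 _ hp
      rw [mem_ofPred_eq, C.ext_eq (Ioo_subset_Icc_self hr.1)] at h1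
      rw [mem_ofPred_eq, C.topExt_eq (Ioo_subset_Icc_self hr.2.1)] at h2
      exact ⟨hp, h1, h2⟩
  rw [h]
  exact (isOpen_Ioo.preimage continuous_fst).inter
    ((isOpen_lt (C.ext_continuous.comp continuous_fst) continuous_snd).inter
      (isOpen_lt continuous_snd ((C.topExt_continuous v).comp continuous_fst)))

/-- Two strips do not meet after a nonzero shift by the lattice, since a point of a strip determines
the gap that contains it. -/
theorem IsStrip.eq_zero_of_mem {u u' v : ℝ × ℝ} {c d c' d' : ℝ} (hs : C.IsStrip u c d)
    (hs' : C.IsStrip u' c' d') (hv : v ∈ C.lattice) {p : ℝ × ℝ} (hp : p ∈ C.region u c d)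
    (hp' : p + v ∈ C.region u' c' d') : v = 0 := by
  have hg := (hs.gap hp).add hv
  have h0 := (hg.eq_of_mem (hs'.gap hp') (t := p.2 + v.2)
    ⟨by linarith [hp.2.1], by linarith [hp.2.2]⟩ hp'.2).1
  refine C.eq_of_top_eq (x := p.1 + v.1) hv C.lattice.zero_mem ?_ ?_ ?_
  · simpa using Ioo_subset_Icc_self (hs.2.2 _ hp.1).1
  · simpa using Ioo_subset_Icc_self (hs'.2.2 _ hp'.1).1
  · simpa [top] using h0

/-- The points which avoid the shifts of the segment and do not lie over a prescribed finite set of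
points of a shift are dense. -/
theorem exists_generic (T : Set ℝ) (hT : T.Finite) {U : Set (ℝ × ℝ)} {p : ℝ × ℝ} (hU : U ∈ 𝓝 p) :
    ∃ q ∈ U, q ∈ C.slitPlane ∧ ∀ v ∈ C.lattice, q.1 - v.1 ∉ T := by
  obtain ⟨u, hu, t, ht, hut⟩ := mem_nhds_prod_iff.1 hU
  have hE : ((fun q : (ℝ × ℝ) × ℝ => q.1.1 + q.2) '' ((C.lattice : Set (ℝ × ℝ)) ×ˢ T)).Countable :=
    (C.lattice_countable.prod hT.countable).image _
  obtain ⟨x, hxu, hxE⟩ := mem_closure_iff_nhds.1 (hE.dense_compl ℝ p.1) u hu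
  have hH : ((fun v => C.top v x) '' (C.lattice : Set (ℝ × ℝ))).Countable :=
    C.lattice_countable.image _
  obtain ⟨y, hyt, hyH⟩ := mem_closure_iff_nhds.1 (hH.dense_compl ℝ p.2) t ht
  refine ⟨(x, y), hut ⟨hxu, hyt⟩, ?_, fun v hv hvT => hxE ⟨(v, x - v.1), ⟨hv, hvT⟩, by simp⟩⟩
  by_contra hs
  obtain ⟨v, hv, -, h⟩ := C.notMem_slitPlane_iff.1 hs
  exact hyH ⟨v, hv, h.symm⟩

theorem StreetData.isFundamentalDomain (hC : C.IsIrreducible) {g₀ g₁ g₂ : ℝ × ℝ}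
    (hD : C.StreetData g₀ g₁ g₂) :
    C.IsFundamentalDomain (⋃ τ, C.region (![g₀, g₁, g₂] τ) (![m + g₁.1, 0, g₂.1] τ)
      (![g₂.1, m + g₁.1, m] τ)) := by
  set D := ⋃ τ, C.region (![g₀, g₁, g₂] τ) (![m + g₁.1, 0, g₂.1] τ)
      (![g₂.1, m + g₁.1, m] τ) with hDdef
  refine ⟨isOpen_iUnion fun τ => (hD.isStrip τ).isOpen_region, ?_, ?_⟩
  · intro v hv hv0
    rw [disjoint_left]
    rintro _ hp ⟨p, hp', rfl⟩
    obtain ⟨τ, hτ⟩ := mem_iUnion.1 hp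
    obtain ⟨τ', hτ'⟩ := mem_iUnion.1 hp'
    exact hv0 ((hD.isStrip τ').eq_zero_of_mem (hD.isStrip τ) hv hτ' hτ)
  · rw [eq_univ_iff_forall]
    intro p
    obtain ⟨S, hS, hφ⟩ := C.exists_bound
    -- Only finitely many shifts of `D` come near `p`.
    set R := |p.1| + |p.2| + 1 + m + S + ∑ τ : Fin 3, |(![g₀, g₁, g₂] τ).2| with hR
    have hfin := C.lattice_finite R
    set K := ⋃ v ∈ {v | v ∈ C.lattice ∧ |v.1| ≤ R ∧ |v.2| ≤ R}, (fun p => p + v) '' closure D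
      with hK
    have hKc : IsClosed K := hfin.isClosed_biUnion fun v _ =>
      (Homeomorph.addRight v).isClosedMap _ isClosed_closure
    suffices hpK : p ∈ K by
      obtain ⟨v, hv, hpv⟩ := mem_iUnion₂.1 hpK
      exact mem_iUnion₂.2 ⟨v, hv.1, hpv⟩
    by_contra hpK
    have hnear : Ioo (p.1 - 1) (p.1 + 1) ×ˢ Ioo (p.2 - 1) (p.2 + 1) ∈ 𝓝 p :=
      prod_mem_nhds (Ioo_mem_nhds (by linarith) (by linarith))
        (Ioo_mem_nhds (by linarith) (by linarith))
    obtain ⟨q, ⟨hqK, hq1, hq2⟩, hqs, hqT⟩ := C.exists_generic {0, m, m + g₁.1, g₂.1} (by simp)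
      (inter_mem (hKc.isOpen_compl.mem_nhds hpK) hnear)
    obtain ⟨y, hy, hys, hclear⟩ := hC.exists_first_below q.1 q.2
    obtain ⟨v, hv, hqv, rfl⟩ := C.notMem_slitPlane_iff.1 hys
    have hT := hqT v hv
    simp only [mem_insert_iff, mem_singleton_iff, not_or] at hT
    obtain ⟨τ, hτ⟩ := exists_mem_Ioo_of_ne ⟨lt_of_le_of_ne hqv.1 (Ne.symm hT.1),
      lt_of_le_of_ne hqv.2 hT.2.1⟩ hT.2.2.1 hT.2.2.2
    have hs := hD.isStrip τ
    have hr := hs.2.2 _ hτ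
    have hlow : C.φ (q.1 - v.1) < q.2 - v.2 := by
      have : C.φ (q.1 - v.1) + v.2 < q.2 := hy
      linarith
    have hhigh : q.2 - v.2 < C.top (![g₀, g₁, g₂] τ) (q.1 - v.1) := by
      by_contra! hle
      have h1 := ((hr.meets hs.1).gap.add hv).high
      rw [sub_add_cancel] at h1
      rcases hle.eq_or_lt with h | h
      · rw [h, sub_add_cancel] at h1
        exact h1 hqs
      · refine h1 (hclear _ ⟨?_, by linarith⟩)
        have := hr.2.2.1
        change C.φ (q.1 - v.1) + v.2 < _
        linarith
    have hmem : q - v ∈ D := mem_iUnion.2 ⟨τ, hτ, hlow, hhigh⟩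
    refine hqK (mem_iUnion₂.2 ⟨v, ⟨hv, ?_⟩, q - v, subset_closure hmem, by simp⟩)
    have b1 := abs_le.1 (hφ _ hqv)
    have b2 := abs_le.1 (hφ _ (Ioo_subset_Icc_self hr.2.1))
    have b3 : |(![g₀, g₁, g₂] τ).2| ≤ ∑ τ : Fin 3, |(![g₀, g₁, g₂] τ).2| :=
      Finset.single_le_sum (f := fun τ : Fin 3 => |(![g₀, g₁, g₂] τ).2|)
        (fun _ _ => abs_nonneg _) (Finset.mem_univ τ)
    have b4 := abs_le.1 b3
    have b5 := (abs_nonneg _).trans b3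
    simp only [top] at hhigh
    have := C.m_pos
    constructor <;> rw [abs_le] <;> constructor <;>
    linarith [hq1.1, hq1.2, hq2.1, hq2.2, hqv.1, hqv.2, neg_abs_le p.1, le_abs_self p.1,
      neg_abs_le p.2, le_abs_self p.2, abs_nonneg p.1, abs_nonneg p.2]

/-! ### The picture of the three streets and its symmetry -/

theorem StreetData.threeStreets (hC : C.IsIrreducible) {g₀ g₁ g₂ : ℝ × ℝ}
    (hD : C.StreetData g₀ g₁ g₂) :
    C.ThreeStreets ![g₀, g₁, g₂] ![m + g₁.1, 0, g₂.1] ![g₂.1, m + g₁.1, m] := by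
  have i1 := hD.meets₁.inner
  have i2 := hD.meets₂.inner
  have hs := hD.fst_add
  have hlt := hD.lt
  have hm := C.m_pos
  have h01 : g₀.1 ≠ g₁.1 := by linarith [i2.1]
  have h02 : g₀.1 ≠ g₂.1 := by linarith [i1.2]
  have h12 : g₁.1 ≠ g₂.1 := by linarith
  have ne : ∀ {u v : ℝ × ℝ}, u.1 ≠ v.1 → u ≠ v := fun h e => h (congrArg Prod.fst e)
  constructor
  · exact hD.isStreet_iff
  · intro τ τ' h
    fin_cases τ <;> fin_cases τ' <;> first | rfl | skip
    · exact absurd h (ne h01)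
    · exact absurd h (ne h02)
    · exact absurd h (ne h01.symm)
    · exact absurd h (ne h12)
    · exact absurd h (ne h02.symm)
    · exact absurd h (ne h12.symm)
  · simp [Fin.sum_univ_three]
    ring
  · exact hD.add_eq hC
  · rfl
  · rfl
  · rfl
  · rfl
  · have e : (C.rightEnd + g₁).2 = C.top g₁ (m + g₁.1) := by simp [rightEnd, top]
    refine ⟨rfl, ?_⟩
    change (C.rightEnd + g₁).2 ∈ Ioo (C.φ (m + g₁.1)) (C.top g₀ (m + g₁.1))
    rw [e]
    exact ⟨hD.meets₁.gap.lt, hD.top_lt_top (left_mem_Icc.2 hlt.le) hD.meets₁ (ne h01.symm)⟩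
  · have e : (C.leftEnd + g₂).2 = C.top g₂ g₂.1 := by simp [leftEnd, top]
    refine ⟨zero_add _, ?_⟩
    change (C.leftEnd + g₂).2 ∈ Ioo (C.φ g₂.1) (C.top g₀ g₂.1)
    rw [e]
    exact ⟨hD.meets₂.gap.lt, hD.top_lt_top (right_mem_Icc.2 hlt.le) hD.meets₂ (ne h02.symm)⟩
  · change 0 < m + g₁.1 ∧ g₂.1 < m ∧ 0 < m + g₁.1 - g₀.1 ∧ g₂.1 - g₀.1 < m
    exact ⟨i1.1, i2.2, by linarith [i2.2], by linarith [i1.1]⟩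
  · intro τ τ' hne
    rw [disjoint_left]
    rintro p ⟨⟨h1, h2⟩, -⟩ ⟨⟨h1', h2'⟩, -⟩
    fin_cases τ <;> fin_cases τ' <;> first | exact hne rfl | skip
    all_goals
      simp at h1 h2 h1' h2'
      linarith
  · exact hD.isFundamentalDomain hC

theorem ThreeStreets.lt {h : Fin 3 → ℝ × ℝ} {l r : Fin 3 → ℝ} (T : C.ThreeStreets h l r)
    (τ : Fin 3) : l τ < r τ :=
  ((T.streets _ _ _).2 ⟨τ, rfl, rfl, rfl⟩).1.2.1

/-- The position of the three streets determines their numbering. -/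
theorem ThreeStreets.unique {C' : TorusPlane m} {h h' : Fin 3 → ℝ × ℝ} {l l' r r' : Fin 3 → ℝ}
    (T : C.ThreeStreets h l r) (T' : C'.ThreeStreets h' l' r')
    (hS : ∀ v c d, C'.IsStreet v c d ↔ C.IsStreet v c d) : h' = h ∧ l' = l ∧ r' = r := by
  have key : ∀ τ, ∃ σ, h' τ = h σ ∧ l' τ = l σ ∧ r' τ = r σ := fun τ =>
    (T.streets _ _ _).1 ((hS _ _ _).1 ((T'.streets _ _ _).2 ⟨τ, rfl, rfl, rfl⟩))
  have q0 := T.lt 0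
  have q1 := T.inside.1
  have q2 := T.inside.2.1
  have s1 : h' 1 = h 1 ∧ l' 1 = l 1 ∧ r' 1 = r 1 := by
    obtain ⟨σ, hσ⟩ := key 1
    have e := hσ.2.1
    rw [T'.left] at e
    fin_cases σ
    · exact absurd e q1.ne
    · exact hσ
    · exact absurd (e.trans T.right_attached.symm) (q1.trans q0).ne
  have s2 : h' 2 = h 2 ∧ l' 2 = l 2 ∧ r' 2 = r 2 := by
    obtain ⟨σ, hσ⟩ := key 2
    have e := hσ.2.2
    rw [T'.right] at e
    fin_cases σ
    · exact absurd e q2.ne'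
    · exact absurd (e.trans T.left_attached) (q0.trans q2).ne'
    · exact hσ
  have s0 : h' 0 = h 0 ∧ l' 0 = l 0 ∧ r' 0 = r 0 := by
    obtain ⟨σ, hσ⟩ := key 0
    have e := hσ.2.1
    rw [← T'.left_attached, s1.2.2, T.left_attached] at e
    fin_cases σ
    · exact hσ
    · exact absurd (e.trans T.left) q1.ne'
    · exact absurd (e.trans T.right_attached.symm) q0.ne
  refine ⟨?_, ?_, ?_⟩ <;> ext τ : 1 <;> fin_cases τ
  exacts [s0.1, s1.1, s2.1, s0.2.1, s1.2.1, s2.2.1, s0.2.2, s1.2.2, s2.2.2]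

variable (C) in
/-- Reversal carries the trajectory which ends over `x - v.1` to the one which starts over
`m - (x - v.1)`. -/
theorem reverse_reaches_iff {v : ℝ × ℝ} (hv : v ∈ C.lattice) (x : ℝ) :
    C.reverse.Reaches v x ↔ C.Reaches v (m - x + v.1) := by
  have e0 : C.reverse.φ x = -C.φ (m - x) := rfl
  have e1 : C.reverse.top v x = -C.φ (m - x + v.1) + v.2 := by
    simp only [top, reverse]
    rw [show m - (x - v.1) = m - x + v.1 by ring]
  have e2 : C.top v (m - x + v.1) = C.φ (m - x) + v.2 := by simp [top]
  have e3 : ∀ y, (x, y) ∈ C.reverse.slitPlane ↔ (m - x + v.1, -y + v.2) ∈ C.slitPlane := fun y =>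
    (C.mem_reverse_slitPlane_iff x y).trans (C.add_mem_slitPlane_iff hv (m - x, -y)).symm
  rw [Reaches, Reaches, e0, e1, e2]
  constructor
  · rintro ⟨h1, h2, h3, h4⟩
    refine ⟨⟨by linarith [h2.2], by linarith [h2.1]⟩, ⟨by linarith [h1.2], by linarith [h1.1]⟩,
      by linarith, fun y hy => ?_⟩
    have := (e3 (-y + v.2)).1 (h4 _ ⟨by linarith [hy.2], by linarith [hy.1]⟩)
    rwa [show -(-y + v.2) + v.2 = y by ring] at this
  · rintro ⟨h1, h2, h3, h4⟩
    exact ⟨⟨by linarith [h2.2], by linarith [h2.1]⟩, ⟨by linarith [h1.2], by linarith [h1.1]⟩,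
      by linarith, fun y hy => (e3 y).2 (h4 _ ⟨by linarith [hy.2], by linarith [hy.1]⟩)⟩

variable (C) in
theorem reverse_isStrip_iff (v : ℝ × ℝ) (c d : ℝ) :
    C.reverse.IsStrip v c d ↔ C.IsStrip v (m - d + v.1) (m - c + v.1) := by
  constructor
  · rintro ⟨hv, hcd, h⟩
    refine ⟨hv, by linarith, fun x hx => ?_⟩
    have := (C.reverse_reaches_iff hv _).1
      (h (m - x + v.1) ⟨by linarith [hx.2], by linarith [hx.1]⟩)
    rwa [show m - (m - x + v.1) + v.1 = x by ring] at this
  · rintro ⟨hv, hcd, h⟩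
    exact ⟨hv, by linarith, fun x hx => (C.reverse_reaches_iff hv x).2
      (h _ ⟨by linarith [hx.2], by linarith [hx.1]⟩)⟩

variable (C) in
theorem reverse_isStreet_iff (v : ℝ × ℝ) (c d : ℝ) :
    C.reverse.IsStreet v c d ↔ C.IsStreet v (m - d + v.1) (m - c + v.1) := by
  rw [IsStreet, IsStreet, reverse_isStrip_iff]
  refine and_congr_right fun _ => ⟨fun h c' d' hc hd hs => ?_, fun h c' d' hc hd hs => ?_⟩
  · have := h (m - d' + v.1) (m - c' + v.1) (by linarith) (by linarith) (by
      rw [reverse_isStrip_iff]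
      rwa [show m - (m - c' + v.1) + v.1 = c' by ring, show m - (m - d' + v.1) + v.1 = d' by ring])
    exact ⟨by linarith [this.2], by linarith [this.1]⟩
  · have := h (m - d' + v.1) (m - c' + v.1) (by linarith) (by linarith)
      ((C.reverse_isStrip_iff v c' d').1 hs)
    exact ⟨by linarith [this.2], by linarith [this.1]⟩

/-- Each of the three streets is carried to itself by the involution. -/
theorem ThreeStreets.reverse_isStreet_iff {h : Fin 3 → ℝ × ℝ} {l r : Fin 3 → ℝ}
    (T : C.ThreeStreets h l r) (v : ℝ × ℝ) (c d : ℝ) :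
    C.reverse.IsStreet v c d ↔ C.IsStreet v c d := by
  have hsum : ∀ τ, l τ + r τ = m + (h τ).1 := by
    have w1 : m + (h 1).1 = l 0 := T.left_wall.1
    have w2 : (0 : ℝ) + (h 2).1 = r 0 := T.right_wall.1
    have w0 : (h 1).1 + (h 2).1 = (h 0).1 := congrArg Prod.fst T.heights
    have a1 := T.left
    have a2 := T.left_attached
    have a3 := T.right_attached
    have a4 := T.right
    intro τ
    fin_cases τ
    · change l 0 + r 0 = m + (h 0).1
      linarith
    · change l 1 + r 1 = m + (h 1).1
      linarith
    · change l 2 + r 2 = m + (h 2).1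
      linarith
  rw [C.reverse_isStreet_iff, T.streets, T.streets]
  refine exists_congr fun τ => and_congr_right ?_
  rintro rfl
  have := hsum τ
  constructor <;> rintro ⟨h1, h2⟩ <;> constructor <;> linarith

theorem IsIrreducible.exists_threeStreets (hC : C.IsIrreducible) :
    ∃ (h : Fin 3 → ℝ × ℝ) (l r : Fin 3 → ℝ),
      C.ThreeStreets h l r ∧ C.reverse.ThreeStreets h l r := by
  obtain ⟨g₀, g₁, g₂, hD⟩ := hC.exists_streetData
  obtain ⟨g₀', g₁', g₂', hD'⟩ := (C.isIrreducible_reverse hC).exists_streetData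
  have T := hD.threeStreets hC
  have T' := hD'.threeStreets (C.isIrreducible_reverse hC)
  obtain ⟨e1, e2, e3⟩ := T.unique T' T.reverse_isStreet_iff
  rw [e1, e2, e3] at T'
  exact ⟨_, _, _, T, T'⟩

end TorusPlane

/-! ### The surface: no saddle connections and no periodic leaves in the slit planes -/

namespace TorusPlane

variable {m : ℝ} {C : TorusPlane m}

theorem mem_slitPlaneWithEnds_of_mem {p : ℝ × ℝ} (hp : p ∈ C.slitPlane) :
    p ∈ C.slitPlaneWithEnds :=
  fun v hv h => hp v hv ⟨Ioo_subset_Icc_self h.1, h.2⟩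

theorem IsEnd.mem_slitPlaneWithEnds {p : ℝ × ℝ} (hp : C.IsEnd p) : p ∈ C.slitPlaneWithEnds := by
  intro v hv h
  have hm := C.m_pos.le
  have hvt : p.2 = C.top v p.1 := sub_eq_iff_eq_add.1 h.2
  have key : ∀ u ∈ C.lattice, p.1 - u.1 = 0 ∨ p.1 - u.1 = m → p.2 = C.top u p.1 → False := by
    intro u hu h0 hut
    have hmem : p.1 - u.1 ∈ Icc 0 m := by
      rcases h0 with h0 | h0 <;> rw [h0]
      exacts [left_mem_Icc.2 hm, right_mem_Icc.2 hm]
    have huv := C.eq_of_top_eq hu hv hmem (Ioo_subset_Icc_self h.1) (hut.symm.trans hvt)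
    rw [huv] at h0
    rcases h0 with h0 | h0
    · exact h.1.1.ne' h0
    · exact h.1.2.ne h0
  obtain ⟨u, hu, rfl | rfl⟩ := hp
  · exact key u hu (Or.inl (by simp [leftEnd])) (by simp [leftEnd, top])
  · exact key u hu (Or.inr (by simp [rightEnd])) (by simp [rightEnd, top])

/-- A gap is not longer than a vertical period. -/
theorem Gap.eq_zero_of_vertical {x y₀ y₁ w : ℝ} (h : C.Gap x y₀ y₁) (hw : (0, w) ∈ C.lattice)
    (hlt : |w| < y₁ - y₀) : w = 0 := by
  have hlt' := abs_lt.1 hlt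
  rcases lt_trichotomy w 0 with h0 | h0 | h0
  · have := (h.add hw).high
    simp only [add_zero] at this
    exact absurd (h.clear _ ⟨by linarith [hlt'.1], by linarith⟩) this
  · exact h0
  · have := (h.add hw).low
    simp only [add_zero] at this
    exact absurd (h.clear _ ⟨by linarith, by linarith [hlt'.2]⟩) this

end TorusPlane

namespace TorusDecomposition

variable {V : Type*} [TopologicalSpace V] [ChartedSpace ℂ V] {θ : CotangentField V}
  {a b : Fin 2 → ℝ → V} {m : ℝ} (D : TorusDecomposition θ a b m) (k : Fin 2)

/-- The image of a vertical segment which meets shifts of the transversal segment at most in its ends,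
and there only in their ends, is a path in a leaf. At an end the real part of a primitive is
constant since it is so in the interior. -/
theorem isLeafPath {x y₀ y₁ : ℝ} (hy : y₀ < y₁)
    (hends : ∀ y ∈ Icc y₀ y₁, (x, y) ∈ (D.C k).slitPlaneWithEnds)
    (hclear : ∀ y ∈ Ioo y₀ y₁, (x, y) ∈ (D.C k).slitPlane) :
    IsLeafPath θ fun t => D.proj k (x, y₀ + t * (y₁ - y₀)) := by
  set σ : ℝ → ℝ × ℝ := fun t => (x, y₀ + t * (y₁ - y₀)) with hσ
  have hσc : Continuous σ := by fun_prop
  have hγ : ContinuousOn (fun t => D.proj k (σ t)) (Icc 0 1) := by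
    refine (D.proj_continuous k).comp hσc.continuousOn fun t ht => hends _ ⟨?_, ?_⟩
    · nlinarith [ht.1]
    · nlinarith [ht.2]
  refine ⟨hγ, fun t ht f hf => ?_⟩
  have hev : ∀ᶠ s in 𝓝[Icc 0 1] t, IsPrimitiveNear θ (D.proj k (σ s)) f :=
    (hγ t ht).eventually (eventually_eventually_nhds.2 hf)
  obtain ⟨δ, hδ, hball⟩ := Metric.mem_nhdsWithin_iff.1 hev
  set J := Metric.ball t δ ∩ Icc 0 1 with hJ
  have hconv : Convex ℝ J := (convex_ball t δ).inter (convex_Icc 0 1)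
  have hcont : ContinuousOn (fun s => (f (D.proj k (σ s))).re) J := by
    intro s hs
    have hfc : ContinuousAt f (D.proj k (σ s)) := (hball hs).self_of_nhds.continuousAt
    have hfr : ContinuousAt (fun q => (f q).re) (D.proj k (σ s)) :=
      Complex.continuous_re.continuousAt.comp hfc
    exact hfr.comp_continuousWithinAt (f := fun t => D.proj k (σ t))
      ((hγ s hs.2).mono inter_subset_right)
  have hderiv : ∀ s ∈ interior J, HasDerivAt (fun s => (f (D.proj k (σ s))).re) 0 s := by
    intro s hs
    have hs01 : s ∈ Ioo (0 : ℝ) 1 := by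
      have := interior_mono inter_subset_right hs
      rwa [interior_Icc] at this
    have hp : σ s ∈ (D.C k).slitPlane := hclear _ ⟨by nlinarith [hs01.1], by nlinarith [hs01.2]⟩
    have h1 := hσc.continuousAt.eventually (D.proj_measure k _ hp f (hball (interior_subset hs)))
    refine (hasDerivAt_const s (f (D.proj k (σ s))).re).congr_of_eventuallyEq ?_
    filter_upwards [h1] with s' hs'
    simpa [hσ, sub_eq_zero] using hs'
  have hdiff : DifferentiableOn ℝ (fun s => (f (D.proj k (σ s))).re) (interior J) :=
    fun s hs => (hderiv s hs).differentiableAt.differentiableWithinAt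
  have hmono := monotoneOn_of_deriv_nonneg hconv hcont hdiff fun s hs => (hderiv s hs).deriv.ge
  have hanti := antitoneOn_of_deriv_nonpos hconv hcont hdiff fun s hs => (hderiv s hs).deriv.le
  have htJ : t ∈ J := ⟨Metric.mem_ball_self hδ, ht⟩
  filter_upwards [inter_mem_nhdsWithin (Icc 0 1) (Metric.ball_mem_nhds t hδ)] with s hs
  have hsJ : s ∈ J := ⟨hs.2, hs.1⟩
  rcases le_total s t with h | h
  · exact le_antisymm (hmono hsJ htJ h) (hanti hsJ htJ h)
  · exact le_antisymm (hanti htJ hsJ h) (hmono htJ hsJ h)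

theorem apply_proj_eq_zero_of_isEnd {p : ℝ × ℝ} (hp : (D.C k).IsEnd p) : θ (D.proj k p) = 0 := by
  rw [D.saddles]
  obtain ⟨v, hv, rfl | rfl⟩ := hp
  · exact Or.inl (by rw [D.proj_periodic k _ v hv, D.proj_leftEnd])
  · exact Or.inr (by rw [D.proj_periodic k _ v hv, D.proj_rightEnd])

theorem apply_proj_ne_zero {p : ℝ × ℝ} (hp : p ∈ (D.C k).slitPlane) : θ (D.proj k p) ≠ 0 := by
  rw [Ne, D.saddles, not_or]
  exact D.proj_ne_saddle k p hp

theorem isIrreducible (hgen : IsGenericFoliation θ) : (D.C k).IsIrreducible := by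
  constructor
  · intro x y₀ y₁ hgap h0 h1
    have hin : ∀ t ∈ Ioo (0 : ℝ) 1, (x, y₀ + t * (y₁ - y₀)) ∈ (D.C k).slitPlane := fun t ht =>
      hgap.clear _ ⟨by nlinarith [ht.1, hgap.lt], by nlinarith [ht.2, hgap.lt]⟩
    refine hgen.no_saddle_connection ⟨_, D.isLeafPath k hgap.lt (fun y hy => ?_) hgap.clear,
      fun t ht t' ht' he => ?_, ?_, ?_, fun t ht => D.apply_proj_ne_zero k (hin t ht)⟩
    · rcases hy.1.eq_or_lt with rfl | hlt
      · exact h0.mem_slitPlaneWithEnds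
      rcases hy.2.eq_or_lt with rfl | hlt'
      · exact h1.mem_slitPlaneWithEnds
      exact TorusPlane.mem_slitPlaneWithEnds_of_mem (hgap.clear y ⟨hlt, hlt'⟩)
    · have hv := D.proj_injective k _ (hin t ht) _ (hin t' ht') he
      rw [Prod.mk_sub_mk, sub_self, show y₀ + t' * (y₁ - y₀) - (y₀ + t * (y₁ - y₀)) =
        (t' - t) * (y₁ - y₀) by ring] at hv
      have hpos := sub_pos.2 hgap.lt
      have h2 := hgap.eq_zero_of_vertical hv (by
        rw [abs_mul, abs_of_pos hpos]
        have : |t' - t| < 1 := abs_lt.2 ⟨by linarith [ht.2, ht'.1], by linarith [ht.1, ht'.2]⟩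
        exact mul_lt_of_lt_one_left hpos this)
      rcases mul_eq_zero.1 h2 with h2 | h2
      · linarith
      · exact absurd h2 hpos.ne'
    · exact D.apply_proj_eq_zero_of_isEnd k (by simpa using h0)
    · exact D.apply_proj_eq_zero_of_isEnd k (by simpa using h1)
  · intro x w hw hwL
    by_contra! hfree
    -- The least vertical period makes the leaf a simple closed one.
    have hfin : {v : ℝ × ℝ | (v ∈ (D.C k).lattice ∧ |v.1| ≤ w ∧ |v.2| ≤ w) ∧
        v.1 = 0 ∧ 0 < v.2}.Finite := ((D.C k).lattice_finite w).subset fun v hv => hv.1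
    obtain ⟨⟨z, w₀⟩, ⟨⟨hvL, -, hvw⟩, hz, hw₀⟩, hmin⟩ := exists_min_image _ Prod.snd hfin
      ⟨(0, w), ⟨hwL, by simpa using hw.le, (abs_of_pos hw).le⟩, rfl, hw⟩
    simp only at hz hw₀ hvw hmin
    subst hz
    have hmin' : ∀ u, (0, u) ∈ (D.C k).lattice → |u| < w₀ → u = 0 := by
      have hpos : ∀ u, (0, u) ∈ (D.C k).lattice → 0 < u → w₀ ≤ u := by
        intro u hu hu0
        by_contra! hlt
        exact absurd (hmin (0, u) ⟨⟨hu, by simpa using hw.le, by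
          rw [abs_of_pos hu0]; rw [abs_of_pos hw₀] at hvw; exact hlt.le.trans hvw⟩, rfl, hu0⟩)
          (not_le.2 hlt)
      intro u hu hlt
      rcases lt_trichotomy u 0 with h | h | h
      · have := hpos (-u) (by simpa using (D.C k).lattice.neg_mem hu) (by linarith)
        linarith [(abs_lt.1 hlt).1]
      · exact h
      · linarith [hpos u hu h, (abs_lt.1 hlt).2]
    refine hgen.no_periodic_leaf ⟨_, D.isLeafPath k (x := x) hw₀
      (fun y _ => TorusPlane.mem_slitPlaneWithEnds_of_mem (hfree y)) (fun y _ => hfree y),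
      fun t ht t' ht' he => ?_, ?_, fun t _ => D.apply_proj_ne_zero k (hfree _)⟩
    · have hv := D.proj_injective k _ (hfree _) _ (hfree _) he
      rw [Prod.mk_sub_mk, sub_self, show 0 + t' * (w₀ - 0) - (0 + t * (w₀ - 0)) =
        (t' - t) * w₀ by ring] at hv
      have h2 := hmin' _ hv (by
        rw [abs_mul, abs_of_pos hw₀]
        have : |t' - t| < 1 := abs_lt.2 ⟨by linarith [ht.2, ht'.1], by linarith [ht.1, ht'.2]⟩
        exact mul_lt_of_lt_one_left hw₀ this)
      rcases mul_eq_zero.1 h2 with h2 | h2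
      · linarith
      · exact absurd h2 hw₀.ne'
    · simpa using (D.proj_periodic k (x, 0) (0, w₀) hvL).symm

end TorusDecomposition

theorem lemma7 {V : Type*} [TopologicalSpace V] [T2Space V] [CompactSpace V] [ConnectedSpace V]
    [ChartedSpace ℂ V] [IsManifold 𝓘(ℂ) ω V] (hV : genus V = 2)
    (θ : CotangentField V) (hθ : θ ∈ holomorphicForms V) (hgen : IsGenericFoliation θ)
    (a b : Fin 2 → ℝ → V) (hab : IsTransversalCanonicalBasis θ a b)
    (m : ℝ) (D : TorusDecomposition θ a b m) (k : Fin 2) :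
    ∃ (h : Fin 3 → ℝ × ℝ) (l r : Fin 3 → ℝ),
      (D.C k).ThreeStreets h l r ∧ (D.C k).reverse.ThreeStreets h l r :=
  (D.isIrreducible k hgen).exists_threeStreets
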